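/- Notation. Let $Q_8=\langle x,y\mid x^2=y^2,\ y^4=1,\ xyx=y\rangle$ be the quaternion group of order $8$ and $Q_8^{ab}$ its abelianization. Let $1,\chi_1,\chi_2,\chi_1\chi_2$ be the one-dimensional representations of $Q_8^{ab}$, where $\chi_1(x)=-1$, $\chi_1(y)=1$, $\chi_2(x)=1$, $\chi_2(y)=-1$. For a finite abelian group $G$ let $R(G)$ be the Grothendieck group of finite-dimensional complex representations of $G$. Let $K_0(\mathbf Z_2[G];\mathbf Q_2)$ be the relative Grothendieck group generated by triples $[A,\phi,B]$, where $A,B$ are finitely generated projective $\mathbf Z_2[G]$-modules and $\phi:A\otimes_{\mathbf Z_2}\mathbf Q_2\to B\otimes_{\mathbf Z_2}\mathbf Q_2$ is an isomorphism of $\mathbf Q_2[G]$-modules, subject to additivity on short exact sequences of triples and to $[A,\psi\phi,C]=[A,\phi,B]+[B,\psi,C]$. Fix a field isomorphism $\iota:\mathbf C\cong\overline{\mathbf Q_2}$, through which complex representations are regarded as representations over $\overline{\mathbf Q_2}$. For $\Phi\in GL_n(\mathbf Q_2[G])$ put $\mathrm{Det}(\Phi)(\rho)=\det(\rho(\Phi))$.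 Let $G$ be $Q_8^{ab}$ or one of its subgroups. Then $\mathrm{Det}(\Phi)$ defines an element of $\mathrm{Hom}(R(G),\mathbf Q_2^*)$, and the Hom-description is the isomorphism $$K_0(\mathbf Z_2[G];\mathbf Q_2)\cong \frac{\mathrm{Hom}(R(G),\mathbf Q_2^*)}{\mathrm{Det}(\mathbf Z_2[G]^*)}$$ which sends $[A,\phi,B]$, for $A,B$ free with bases $x_1,\dots,x_n$ and $y_1,\dots,y_n$, to the class of $\mathrm{Det}(\Phi)$, where $\phi(x_i)=\sum_j\Phi_{ij}y_j$. Let $v_2$ be the $2$-adic valuation. Proposition 2.6. (i) The Hom-description for $G=Q_8^{ab}$ exists, and there is an isomorphism $$K_0(\mathbf Z_2[Q_8^{ab}];\mathbf Q_2)\cong \mathrm{Hom}(R(Q_8^{ab}),\mathbf Z)\times(\mathbf Z/4)^*$$ which sends the element with Hom-description $[f]$, for any $f\in \mathrm{Hom}(R(Q_8^{ab}),\mathbf Q_2^*)$, to $$\bigl(\chi\mapsto v_2(f(\chi)),\ \ f(s)\,2^{-v_2(f(s))}\ (\mathrm{mod}\ 4)\bigr),\qquad s=1+\chi_1+\chi_2+\chi_1\chi_2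 .$$ (ii) Let $H\subseteq Q_8^{ab}$ be a subgroup of order one or two. Then the Hom-description for $H$ is an isomorphism $$K_0(\mathbf Z_2[H];\mathbf Q_2)\cong \frac{\mathrm{Hom}(R(H),\mathbf Q_2^*)}{\mathrm{Hom}(R(H),\mathbf Z_2^*)},$$ and, under the isomorphism of (i), the induction homomorphism $$\mathrm{Ind}_H^{Q_8^{ab}}:K_0(\mathbf Z_2[H];\mathbf Q_2)\to K_0(\mathbf Z_2[Q_8^{ab}];\mathbf Q_2),\qquad [A,\phi,B]\mapsto[\mathbf Z_2[Q_8^{ab}]\otimes_{\mathbf Z_2[H]}A,\ \phi,\ \mathbf Z_2[Q_8^{ab}]\otimes_{\mathbf Z_2[H]}B],$$ sends the element with Hom-description $[f]$ to $$\bigl(\chi\mapsto v_2(f(\mathrm{Res}_H^{Q_8^{ab}}(\chi))),\ 1\ (\mathrm{mod}\ 4)\bigr);$$ in particular its component in $(\mathbf Z/4)^*$ is trivial. -/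

import Mathlib

open scoped TensorProduct

noncomputable section

namespace RelK

/-! ### The relative group `K₀(R; S)` of a homomorphism of commutative rings `R → S` -/

section RelativeK0

/-- A triple `[A, φ, B]`: finitely generated projective `R`-modules `A`, `B` and an isomorphism
`φ : S ⊗ A ≅ S ⊗ B` of `S`-modules. -/
structure Triple (R S : Type) [CommRing R] [CommRing S] [Algebra R S] : Type 1 where
  A : Type
  B : Type
  [addCommGroupA : AddCommGroup A]
  [addCommGroupB : AddCommGroup B]
  [moduleA : Module R A]
  [moduleB : Module R B]
  [finiteA : Module.Finite R A]
  [finiteB : Module.Finite R B]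
  [projectiveA : Module.Projective R A]
  [projectiveB : Module.Projective R B]
  φ : S ⊗[R] A ≃ₗ[S] S ⊗[R] B

attribute [instance] Triple.addCommGroupA Triple.addCommGroupB Triple.moduleA Triple.moduleB
  Triple.finiteA Triple.finiteB Triple.projectiveA Triple.projectiveB

variable (R S : Type) [CommRing R] [CommRing S] [Algebra R S]

/-- `0 → X → Y → Z → 0` is a short exact sequence of triples: two short exact sequences of
`R`-modules that are compatible with the three isomorphisms over `S`. -/
def Triple.IsShortExact {R S : Type} [CommRing R] [CommRing S] [Algebra R S]
    (X Y Z : Triple R S) : Prop :=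
  ∃ (i : X.A →ₗ[R] Y.A) (p : Y.A →ₗ[R] Z.A) (j : X.B →ₗ[R] Y.B) (q : Y.B →ₗ[R] Z.B),
    Function.Injective i ∧ Function.Exact i p ∧ Function.Surjective p ∧
    Function.Injective j ∧ Function.Exact j q ∧ Function.Surjective q ∧
    Y.φ.toLinearMap ∘ₗ i.baseChange S = j.baseChange S ∘ₗ X.φ.toLinearMap ∧
    Z.φ.toLinearMap ∘ₗ p.baseChange S = q.baseChange S ∘ₗ Y.φ.toLinearMap

/-- The defining relations of `K₀(R; S)`: additivity on short exact sequences of triples, and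
`[A, ψφ, C] = [A, φ, B] + [B, ψ, C]`. -/
inductive Triple.Relation : FreeAbelianGroup (Triple R S) → Prop
  | exact (X Y Z : Triple R S) (h : X.IsShortExact Y Z) :
      Triple.Relation (FreeAbelianGroup.of Y - FreeAbelianGroup.of X - FreeAbelianGroup.of Z)
  | comp (A B C : Type) [AddCommGroup A] [AddCommGroup B] [AddCommGroup C]
      [Module R A] [Module R B] [Module R C]
      [Module.Finite R A] [Module.Finite R B] [Module.Finite R C]
      [Module.Projective R A] [Module.Projective R B] [Module.Projective R C]
      (φ : S ⊗[R] A ≃ₗ[S] S ⊗[R] B) (ψ : S ⊗[R] B ≃ₗ[S] S ⊗[R] C) :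
      Triple.Relation (FreeAbelianGroup.of (Triple.mk A C (φ.trans ψ))
        - FreeAbelianGroup.of (Triple.mk A B φ) - FreeAbelianGroup.of (Triple.mk B C ψ))

/-- The relative Grothendieck group `K₀(R; S)`: generators are the triples `[A, φ, B]`. -/
def K0Rel : Type 1 :=
  FreeAbelianGroup (Triple R S) ⧸ AddSubgroup.closure {x | Triple.Relation R S x}

instance : AddCommGroup (K0Rel R S) :=
  inferInstanceAs (AddCommGroup
    (FreeAbelianGroup (Triple R S) ⧸ AddSubgroup.closure {x | Triple.Relation R S x}))

/-- The projection from the free abelian group on the triples to `K₀(R; S)`. -/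
def K0Rel.mk : FreeAbelianGroup (Triple R S) →+ K0Rel R S :=
  QuotientAddGroup.mk' (AddSubgroup.closure {x | Triple.Relation R S x})

/-- The class of a triple in `K₀(R; S)`. -/
def K0Rel.cls {R S : Type} [CommRing R] [CommRing S] [Algebra R S] (X : Triple R S) :
    K0Rel R S :=
  K0Rel.mk R S (FreeAbelianGroup.of X)

theorem K0Rel.mk_eq_zero {x : FreeAbelianGroup (Triple R S)} (h : Triple.Relation R S x) :
    K0Rel.mk R S x = 0 :=
  (QuotientAddGroup.eq_zero_iff _).mpr (AddSubgroup.subset_closure h)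

end RelativeK0

/-! ### Extension of scalars `K₀(R; S) → K₀(R'; S')` along a commutative square of rings -/

section BaseChange

variable (R S R' S' : Type) [CommRing R] [CommRing S] [CommRing R'] [CommRing S']
  [Algebra R S] [Algebra R R'] [Algebra S S'] [Algebra R' S'] [Algebra R S']
  [IsScalarTower R R' S'] [IsScalarTower R S S']

/-- The isomorphism `S' ⊗_{R'} (R' ⊗_R A) ≅ S' ⊗_{R'} (R' ⊗_R B)` induced by
`φ : S ⊗_R A ≅ S ⊗_R B`, where `S' ⊗_{R'} (R' ⊗_R A)` is identified with
`S' ⊗_S (S ⊗_R A)`. -/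
def baseChangeIso {A B : Type} [AddCommGroup A] [AddCommGroup B] [Module R A] [Module R B]
    (φ : S ⊗[R] A ≃ₗ[S] S ⊗[R] B) :
    S' ⊗[R'] (R' ⊗[R] A) ≃ₗ[S'] S' ⊗[R'] (R' ⊗[R] B) :=
  (TensorProduct.AlgebraTensorModule.cancelBaseChange R R' S' S' A ≪≫ₗ
      (TensorProduct.AlgebraTensorModule.cancelBaseChange R S S' S' A).symm) ≪≫ₗ
    LinearEquiv.baseChange S S' _ _ φ ≪≫ₗ
    (TensorProduct.AlgebraTensorModule.cancelBaseChange R S S' S' B ≪≫ₗ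
      (TensorProduct.AlgebraTensorModule.cancelBaseChange R R' S' S' B).symm)

/-- The triple `[R' ⊗ A, φ, R' ⊗ B]`. -/
def Triple.baseChange (X : Triple R S) : Triple R' S' :=
  Triple.mk (R' ⊗[R] X.A) (R' ⊗[R] X.B) (baseChangeIso R S R' S' X.φ)

theorem baseChangeIso_trans {A B C : Type} [AddCommGroup A] [AddCommGroup B] [AddCommGroup C]
    [Module R A] [Module R B] [Module R C]
    (φ : S ⊗[R] A ≃ₗ[S] S ⊗[R] B) (ψ : S ⊗[R] B ≃ₗ[S] S ⊗[R] C) :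
    baseChangeIso R S R' S' (φ.trans ψ) =
      (baseChangeIso R S R' S' φ).trans (baseChangeIso R S R' S' ψ) := by
  have h : LinearEquiv.baseChange S S' _ _ (φ.trans ψ) =
      (LinearEquiv.baseChange S S' _ _ φ).trans (LinearEquiv.baseChange S S' _ _ ψ) := by
    apply LinearEquiv.toLinearMap_injective
    exact LinearMap.baseChange_comp (A := S') φ.toLinearMap ψ.toLinearMap
  ext x
  simp [baseChangeIso, h]

theorem baseChangeIso_comm {A B A' B' : Type} [AddCommGroup A] [AddCommGroup B]
    [AddCommGroup A'] [AddCommGroup B'] [Module R A] [Module R B] [Module R A'] [Module R B']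
    (φ : S ⊗[R] A ≃ₗ[S] S ⊗[R] B) (φ' : S ⊗[R] A' ≃ₗ[S] S ⊗[R] B')
    (i : A →ₗ[R] A') (j : B →ₗ[R] B')
    (h : φ'.toLinearMap ∘ₗ i.baseChange S = j.baseChange S ∘ₗ φ.toLinearMap) :
    (baseChangeIso R S R' S' φ').toLinearMap ∘ₗ (i.baseChange R').baseChange S' =
      (j.baseChange R').baseChange S' ∘ₗ (baseChangeIso R S R' S' φ).toLinearMap := by
  have key : ∀ {C C' : Type} [AddCommGroup C] [AddCommGroup C'] [Module R C] [Module R C']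
      (k : C →ₗ[R] C') (z : S' ⊗[S] (S ⊗[R] C)),
      (k.baseChange R').baseChange S'
          ((TensorProduct.AlgebraTensorModule.cancelBaseChange R R' S' S' C).symm
            (TensorProduct.AlgebraTensorModule.cancelBaseChange R S S' S' C z)) =
        (TensorProduct.AlgebraTensorModule.cancelBaseChange R R' S' S' C').symm
          (TensorProduct.AlgebraTensorModule.cancelBaseChange R S S' S' C'
            ((k.baseChange S).baseChange S' z)) := by
    intro C C' _ _ _ _ k z
    induction z using TensorProduct.induction_on with
    | zero => simp
    | add x y hx hy => simp only [map_add, hx, hy]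
    | tmul s w =>
      induction w using TensorProduct.induction_on with
      | zero => simp
      | add x y hx hy => simp only [TensorProduct.tmul_add, map_add, hx, hy]
      | tmul t c => simp
  apply TensorProduct.AlgebraTensorModule.curry_injective
  ext a
  have h1 := LinearMap.congr_fun h (1 ⊗ₜ[R] a)
  simp only [LinearMap.comp_apply, LinearMap.baseChange_tmul, LinearEquiv.coe_coe] at h1
  simp [baseChangeIso, key, h1]

/-- Extension of scalars keeps a short exact sequence exact when its last term is projective. -/
theorem baseChange_shortExact {A B C : Type} [AddCommGroup A] [AddCommGroup B] [AddCommGroup C]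
    [Module R A] [Module R B] [Module R C] [Module.Projective R C]
    (i : A →ₗ[R] B) (p : B →ₗ[R] C) (hi : Function.Injective i) (hip : Function.Exact i p)
    (hp : Function.Surjective p) :
    Function.Injective (i.baseChange R') ∧ Function.Exact (i.baseChange R') (p.baseChange R') ∧
      Function.Surjective (p.baseChange R') := by
  refine ⟨?_, lTensor_exact R' hip hp, LinearMap.lTensor_surjective R' hp⟩
  obtain ⟨l, hl⟩ := Module.projective_lifting_property p LinearMap.id hp
  obtain ⟨-, r, hr⟩ := ((Function.Exact.split_tfae' hip).out 0 1 rfl rfl).mp ⟨hi, l, hl⟩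
  have h2 : (r.baseChange R') ∘ₗ (i.baseChange R') = LinearMap.id := by
    rw [← LinearMap.baseChange_comp, hr, LinearMap.baseChange_id]
  exact Function.LeftInverse.injective (g := r.baseChange R') (LinearMap.congr_fun h2)

theorem Triple.IsShortExact.baseChange {X Y Z : Triple R S} (h : X.IsShortExact Y Z) :
    (X.baseChange R S R' S').IsShortExact (Y.baseChange R S R' S') (Z.baseChange R S R' S') := by
  obtain ⟨i, p, j, q, h1, h2, h3, h4, h5, h6, h7, h8⟩ := h
  obtain ⟨a1, a2, a3⟩ := baseChange_shortExact R R' i p h1 h2 h3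
  obtain ⟨b1, b2, b3⟩ := baseChange_shortExact R R' j q h4 h5 h6
  exact ⟨i.baseChange R', p.baseChange R', j.baseChange R', q.baseChange R', a1, a2, a3, b1, b2, b3,
    baseChangeIso_comm R S R' S' _ _ _ _ h7, baseChangeIso_comm R S R' S' _ _ _ _ h8⟩

/-- Extension of scalars `K₀(R; S) → K₀(R'; S')`, `[A, φ, B] ↦ [R' ⊗ A, φ, R' ⊗ B]`. -/
def K0Rel.baseChange : K0Rel R S →+ K0Rel R' S' :=
  QuotientAddGroup.lift _
    (FreeAbelianGroup.lift fun X : Triple R S => K0Rel.cls (X.baseChange R S R' S')) <| by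
      rw [AddSubgroup.closure_le]
      intro x hx
      change FreeAbelianGroup.lift _ x = 0
      cases hx with
      | exact X Y Z h =>
        have h0 := K0Rel.mk_eq_zero R' S'
          (Triple.Relation.exact _ _ _ (h.baseChange R S R' S'))
        rw [map_sub, map_sub] at h0
        rw [map_sub, map_sub, FreeAbelianGroup.lift_apply_of, FreeAbelianGroup.lift_apply_of,
          FreeAbelianGroup.lift_apply_of]
        exact h0
      | comp A B C φ ψ =>
        have h0 := K0Rel.mk_eq_zero R' S' (Triple.Relation.comp (R' ⊗[R] A) (R' ⊗[R] B)
          (R' ⊗[R] C) (baseChangeIso R S R' S' φ) (baseChangeIso R S R' S' ψ))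
        rw [map_sub, map_sub, ← baseChangeIso_trans] at h0
        rw [map_sub, map_sub, FreeAbelianGroup.lift_apply_of, FreeAbelianGroup.lift_apply_of,
          FreeAbelianGroup.lift_apply_of]
        exact h0

theorem K0Rel.baseChange_cls (X : Triple R S) :
    K0Rel.baseChange R S R' S' (K0Rel.cls X) = K0Rel.cls (X.baseChange R S R' S') :=
  FreeAbelianGroup.lift_apply_of _ _

end BaseChange

/-! ### `K₀(ℤ₂[G]; ℚ₂)` for a finite abelian group and induction from subgroups -/

section GroupRing

/-- The inclusion `ℤ₂[G] → ℚ₂[G]`. -/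
instance algebraIntRat (G : Type) [CommGroup G] :
    Algebra (MonoidAlgebra ℤ_[2] G) (MonoidAlgebra ℚ_[2] G) :=
  (MonoidAlgebra.mapRingHom G (algebraMap ℤ_[2] ℚ_[2])).toAlgebra

/-- The inclusion `k[H] → k[G]` for a subgroup `H` of `G`. -/
instance algebraSubgroup (k : Type) [CommRing k] (G : Type) [CommGroup G] (H : Subgroup G) :
    Algebra (MonoidAlgebra k H) (MonoidAlgebra k G) :=
  (MonoidAlgebra.mapDomainRingHom k H.subtype).toAlgebra

/-- The inclusion `ℤ₂[H] → ℚ₂[G]` for a subgroup `H` of `G`. -/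
instance algebraSubgroupIntRat (G : Type) [CommGroup G] (H : Subgroup G) :
    Algebra (MonoidAlgebra ℤ_[2] H) (MonoidAlgebra ℚ_[2] G) :=
  ((algebraMap (MonoidAlgebra ℤ_[2] G) (MonoidAlgebra ℚ_[2] G)).comp
    (algebraMap (MonoidAlgebra ℤ_[2] H) (MonoidAlgebra ℤ_[2] G))).toAlgebra

instance (G : Type) [CommGroup G] (H : Subgroup G) :
    IsScalarTower (MonoidAlgebra ℤ_[2] H) (MonoidAlgebra ℤ_[2] G) (MonoidAlgebra ℚ_[2] G) :=
  IsScalarTower.of_algebraMap_eq' rfl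

instance (G : Type) [CommGroup G] (H : Subgroup G) :
    IsScalarTower (MonoidAlgebra ℤ_[2] H) (MonoidAlgebra ℚ_[2] H) (MonoidAlgebra ℚ_[2] G) :=
  IsScalarTower.of_algebraMap_eq' <| by
    apply MonoidAlgebra.ringHom_ext <;> intro x <;>
      simp [RingHom.algebraMap_toAlgebra]

/-- The relative group `K₀(ℤ₂[G]; ℚ₂)`. -/
abbrev K0ZQ (G : Type) [CommGroup G] : Type 1 :=
  K0Rel (MonoidAlgebra ℤ_[2] G) (MonoidAlgebra ℚ_[2] G)

/-- Induction `[A, φ, B] ↦ [ℤ₂[G] ⊗ A, φ, ℤ₂[G] ⊗ B]`, the tensor products being over `ℤ₂[H]`. -/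
def ind (G : Type) [CommGroup G] (H : Subgroup G) : K0ZQ H →+ K0ZQ G :=
  K0Rel.baseChange (MonoidAlgebra ℤ_[2] H) (MonoidAlgebra ℚ_[2] H)
    (MonoidAlgebra ℤ_[2] G) (MonoidAlgebra ℚ_[2] G)

end GroupRing

/-! ### The representation group `R(G)` -/

section Representations

/-- A finite-dimensional complex matrix representation of `G`. -/
structure MatRep (G : Type) [Group G] : Type where
  dim : ℕ
  ρ : G →* Matrix (Fin dim) (Fin dim) ℂ

/-- `0 → X → Y → Z → 0` is a short exact sequence of representations. -/
def MatRep.IsShortExact {G : Type} [Group G] (X Y Z : MatRep G) : Prop :=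
  ∃ (i : (Fin X.dim → ℂ) →ₗ[ℂ] (Fin Y.dim → ℂ)) (p : (Fin Y.dim → ℂ) →ₗ[ℂ] (Fin Z.dim → ℂ)),
    Function.Injective i ∧ Function.Exact i p ∧ Function.Surjective p ∧
    (∀ g v, i ((X.ρ g).mulVec v) = (Y.ρ g).mulVec (i v)) ∧
    (∀ g v, p ((Y.ρ g).mulVec v) = (Z.ρ g).mulVec (p v))

/-- The relations `[Y] = [X] + [Z]` for short exact sequences `0 → X → Y → Z → 0`. -/
def MatRep.relations (G : Type) [Group G] : AddSubgroup (FreeAbelianGroup (MatRep G)) :=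
  AddSubgroup.closure {x | ∃ X Y Z : MatRep G, X.IsShortExact Y Z ∧
    x = FreeAbelianGroup.of Y - FreeAbelianGroup.of X - FreeAbelianGroup.of Z}

/-- `R(G)`, the Grothendieck group of finite-dimensional complex representations of `G`. -/
def RepGroup (G : Type) [Group G] : Type :=
  FreeAbelianGroup (MatRep G) ⧸ MatRep.relations G

instance (G : Type) [Group G] : AddCommGroup (RepGroup G) :=
  inferInstanceAs (AddCommGroup (FreeAbelianGroup (MatRep G) ⧸ MatRep.relations G))

/-- The projection from the free abelian group on the representations to `R(G)`. -/
def RepGroup.mk (G : Type) [Group G] : FreeAbelianGroup (MatRep G) →+ RepGroup G :=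
  QuotientAddGroup.mk' (MatRep.relations G)

/-- The class of a representation in `R(G)`. -/
def RepGroup.cls {G : Type} [Group G] (X : MatRep G) : RepGroup G :=
  RepGroup.mk G (FreeAbelianGroup.of X)

/-- The class in `R(G)` of the one-dimensional representation given by a character. -/
def RepGroup.ofChar {G : Type} [Group G] (χ : G →* ℂˣ) : RepGroup G :=
  RepGroup.cls ⟨1, (Matrix.scalar (Fin 1) : ℂ →+* Matrix (Fin 1) (Fin 1) ℂ).toMonoidHom.comp
    ((Units.coeHom ℂ).comp χ)⟩

/-- The restriction of a representation to a subgroup. -/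
def MatRep.res {G : Type} [Group G] (H : Subgroup G) (X : MatRep G) : MatRep H :=
  ⟨X.dim, X.ρ.comp H.subtype⟩

/-- Restriction `R(G) → R(H)`. -/
def res {G : Type} [Group G] (H : Subgroup G) : RepGroup G →+ RepGroup H :=
  QuotientAddGroup.lift _ (FreeAbelianGroup.lift fun X : MatRep G => RepGroup.cls (X.res H)) <| by
    rw [MatRep.relations, AddSubgroup.closure_le]
    rintro _ ⟨X, Y, Z, ⟨i, p, h1, h2, h3, h4, h5⟩, rfl⟩
    have h0 : RepGroup.mk H (FreeAbelianGroup.of (Y.res H) -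
        FreeAbelianGroup.of (X.res H) - FreeAbelianGroup.of (Z.res H)) = 0 :=
      (QuotientAddGroup.eq_zero_iff _).mpr (AddSubgroup.subset_closure
        ⟨X.res H, Y.res H, Z.res H, ⟨i, p, h1, h2, h3, fun g => h4 g, fun g => h5 g⟩, rfl⟩)
    rw [map_sub, map_sub] at h0
    change FreeAbelianGroup.lift _ _ = 0
    rw [map_sub, map_sub, FreeAbelianGroup.lift_apply_of, FreeAbelianGroup.lift_apply_of,
      FreeAbelianGroup.lift_apply_of]
    exact h0

theorem res_cls {G : Type} [Group G] (H : Subgroup G) (X : MatRep G) :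
    res H (RepGroup.cls X) = RepGroup.cls (X.res H) :=
  FreeAbelianGroup.lift_apply_of _ _

end Representations

/-! ### Determinants and the Hom-description -/

section HomDescription

/-- `Hom(R(G), ℚ₂ˣ)`, written additively. -/
abbrev HomQ (G : Type) [Group G] : Type := RepGroup G →+ Additive ℚ_[2]ˣ

/-- The value in `ℚ₂` of `f ∈ Hom(R(G), ℚ₂ˣ)` at `r ∈ R(G)`. -/
def HomQ.val {G : Type} [Group G] (f : HomQ G) (r : RepGroup G) : ℚ_[2] :=
  ((f r).toMul : ℚ_[2]ˣ)

/-- `Hom(R(G), ℤ₂ˣ)` as a subgroup of `Hom(R(G), ℚ₂ˣ)`. -/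
def homZ (G : Type) [Group G] : AddSubgroup (HomQ G) where
  carrier := {f | ∀ r, ‖f.val r‖ = 1}
  zero_mem' := by intro r; simp [HomQ.val]
  add_mem' := by
    intro f g hf hg r
    have h1 : ‖f.val r‖ = 1 := hf r
    have h2 : ‖g.val r‖ = 1 := hg r
    simp only [HomQ.val] at h1 h2
    simp [HomQ.val, h1, h2]
  neg_mem' := by
    intro f hf r
    have h1 : ‖f.val r‖ = 1 := hf r
    simp only [HomQ.val] at h1
    simp [HomQ.val, h1]

variable (ι : ℂ ≃+* AlgebraicClosure ℚ_[2])

/-- The extension to `ℚ₂[G]` of the representation over the algebraic closure of `ℚ₂` that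
corresponds to a complex representation under `ι`. -/
def evalRep {G : Type} [Group G] (X : MatRep G) :
    MonoidAlgebra ℚ_[2] G →ₐ[ℚ_[2]] Matrix (Fin X.dim) (Fin X.dim) (AlgebraicClosure ℚ_[2]) :=
  MonoidAlgebra.lift ℚ_[2] (Matrix (Fin X.dim) (Fin X.dim) (AlgebraicClosure ℚ_[2])) G
    (((ι : ℂ →+* AlgebraicClosure ℚ_[2]).mapMatrix (m := Fin X.dim)).toMonoidHom.comp X.ρ)

/-- `Det(Φ)(ρ) = det(ρ(Φ))`, where `ρ(Φ)` is the matrix of size `n · dim ρ` obtained by applying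
`ρ` to the entries of the matrix `Φ` over `ℚ₂[G]`. -/
def detAt {G : Type} [Group G] {n : ℕ} (Φ : Matrix (Fin n) (Fin n) (MonoidAlgebra ℚ_[2] G))
    (X : MatRep G) : AlgebraicClosure ℚ_[2] :=
  (Matrix.comp (Fin n) (Fin n) (Fin X.dim) (Fin X.dim) _ (Φ.map (evalRep ι X))).det

/-- `f ∈ Hom(R(G), ℚ₂ˣ)` is the determinantal function `Det(Φ)`. -/
def IsDet {G : Type} [Group G] {n : ℕ} (Φ : Matrix (Fin n) (Fin n) (MonoidAlgebra ℚ_[2] G))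
    (f : HomQ G) : Prop :=
  ∀ X : MatRep G,
    algebraMap ℚ_[2] (AlgebraicClosure ℚ_[2]) (f.val (RepGroup.cls X)) = detAt ι Φ X

/-- The `1 × 1` matrix over `ℚ₂[G]` given by a unit of `ℤ₂[G]`. -/
def unitMatrix {G : Type} [CommGroup G] (u : (MonoidAlgebra ℤ_[2] G)ˣ) :
    Matrix (Fin 1) (Fin 1) (MonoidAlgebra ℚ_[2] G) :=
  Matrix.scalar (Fin 1) (algebraMap (MonoidAlgebra ℤ_[2] G) (MonoidAlgebra ℚ_[2] G) u)

theorem detAt_one {G : Type} [Group G] {n : ℕ} (X : MatRep G) :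
    detAt ι (1 : Matrix (Fin n) (Fin n) (MonoidAlgebra ℚ_[2] G)) X = 1 := by
  have h := map_one ((Matrix.compRingEquiv (Fin n) (Fin X.dim) (AlgebraicClosure ℚ_[2])).toRingHom.comp
    ((evalRep ι X : MonoidAlgebra ℚ_[2] G →+* _).mapMatrix (m := Fin n)))
  have h' := congrArg Matrix.det h
  rw [Matrix.det_one] at h'
  exact h'

theorem detAt_mul {G : Type} [Group G] {n : ℕ}
    (Φ Ψ : Matrix (Fin n) (Fin n) (MonoidAlgebra ℚ_[2] G)) (X : MatRep G) :
    detAt ι (Φ * Ψ) X = detAt ι Φ X * detAt ι Ψ X := by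
  have h := map_mul ((Matrix.compRingEquiv (Fin n) (Fin X.dim) (AlgebraicClosure ℚ_[2])).toRingHom.comp
    ((evalRep ι X : MonoidAlgebra ℚ_[2] G →+* _).mapMatrix (m := Fin n))) Φ Ψ
  have h' := congrArg Matrix.det h
  rw [Matrix.det_mul] at h'
  exact h'

/-- The subgroup `Det(ℤ₂[G]ˣ)` of `Hom(R(G), ℚ₂ˣ)`. -/
def detUnits (G : Type) [CommGroup G] : AddSubgroup (HomQ G) where
  carrier := {f | ∃ u : (MonoidAlgebra ℤ_[2] G)ˣ, IsDet ι (unitMatrix u) f}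
  zero_mem' := ⟨1, fun X => by
    have : unitMatrix (1 : (MonoidAlgebra ℤ_[2] G)ˣ) = 1 := by simp [unitMatrix]
    rw [this, detAt_one]
    simp [HomQ.val]⟩
  add_mem' := by
    rintro f g ⟨u, hu⟩ ⟨v, hv⟩
    refine ⟨u * v, fun X => ?_⟩
    have : unitMatrix (u * v) = unitMatrix u * unitMatrix v := by simp [unitMatrix]
    rw [this, detAt_mul, ← hu X, ← hv X]
    simp [HomQ.val]
  neg_mem' := by
    rintro f ⟨u, hu⟩
    refine ⟨u⁻¹, fun X => ?_⟩
    have h1 : unitMatrix u⁻¹ * unitMatrix u = 1 := by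
      rw [unitMatrix, unitMatrix, ← map_mul, ← map_mul, ← Units.val_mul, inv_mul_cancel]
      simp
    have h2 := detAt_one ι (n := 1) X
    rw [← h1, detAt_mul, ← hu X] at h2
    rw [eq_inv_of_mul_eq_one_left h2]
    simp [HomQ.val]

/-- `h` is the Hom-description: for free modules `A`, `B` over `ℤ₂[G]` with bases
`x₁, …, xₙ` and `y₁, …, yₙ`, it sends `[A, φ, B]` to the class of `Det(Φ)`, where the matrix `Φ`
is given by `φ(xᵢ) = ∑ⱼ Φᵢⱼ yⱼ`. -/
def IsHomDescription {G : Type} [CommGroup G] (N : AddSubgroup (HomQ G))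
    (h : K0ZQ G ≃+ HomQ G ⧸ N) : Prop :=
  ∀ (n : ℕ) (T : Triple (MonoidAlgebra ℤ_[2] G) (MonoidAlgebra ℚ_[2] G))
    (x : Module.Basis (Fin n) (MonoidAlgebra ℤ_[2] G) T.A)
    (y : Module.Basis (Fin n) (MonoidAlgebra ℤ_[2] G) T.B)
    (Φ : Matrix (Fin n) (Fin n) (MonoidAlgebra ℚ_[2] G)),
    (∀ i, T.φ (1 ⊗ₜ x i) = ∑ j, Φ i j • (1 ⊗ₜ y j)) →
    ∃ f : HomQ G, IsDet ι Φ f ∧ h (K0Rel.cls T) = QuotientAddGroup.mk f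

end HomDescription

/-! ### The quaternion group of order eight and reduction modulo 4 -/

section Quaternion

/-- The abelianization of the quaternion group `Q₈` of order eight; `Q₈` is generated by
`x = a 1` and `y = xa 0`, which satisfy `x² = y²`, `y⁴ = 1`, `xyx = y`. -/
abbrev Q8ab : Type := Abelianization (QuaternionGroup 2)

/-- The homomorphism `Q₈ → {±1}` with `x ↦ -1`, `y ↦ 1`. -/
def sign₁ : QuaternionGroup 2 →* ℤˣ where
  toFun
    | .a i => (-1) ^ i.val
    | .xa i => (-1) ^ i.val
  map_one' := by decide
  map_mul' := by decide

/-- The homomorphism `Q₈ → {±1}` with `x ↦ 1`, `y ↦ -1`. -/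
def sign₂ : QuaternionGroup 2 →* ℤˣ where
  toFun
    | .a _ => 1
    | .xa _ => -1
  map_one' := by decide
  map_mul' := by decide

/-- The one-dimensional representation `χ₁` of `Q₈ᵃᵇ`. -/
def χ₁ : Q8ab →* ℂˣ := Abelianization.lift ((Units.map (Int.castRingHom ℂ).toMonoidHom).comp sign₁)

/-- The one-dimensional representation `χ₂` of `Q₈ᵃᵇ`. -/
def χ₂ : Q8ab →* ℂˣ := Abelianization.lift ((Units.map (Int.castRingHom ℂ).toMonoidHom).comp sign₂)

/-- The element `1 + χ₁ + χ₂ + χ₁χ₂` of `R(Q₈ᵃᵇ)`. -/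
def charSum : RepGroup Q8ab :=
  RepGroup.ofChar 1 + RepGroup.ofChar χ₁ + RepGroup.ofChar χ₂ + RepGroup.ofChar (χ₁ * χ₂)

/-- The unit `z · 2^(-v₂(z))` of `ℤ₂`, for `z ∈ ℚ₂ˣ`. -/
def unitPart (z : ℚ_[2]ˣ) : ℤ_[2]ˣ :=
  PadicInt.mkUnits (u := (z : ℚ_[2]) * (2 : ℚ_[2]) ^ (-(z : ℚ_[2]).valuation)) <| by
    have h := Padic.norm_eq_zpow_neg_valuation z.ne_zero
    have h2 : ‖(2 : ℚ_[2])‖ = (2 : ℝ)⁻¹ := by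
      simpa using Padic.norm_p (p := 2)
    have h3 : (2 : ℝ) ^ (z : ℚ_[2]).valuation ≠ 0 := by positivity
    rw [norm_mul, h, norm_zpow, h2]
    simp [h3]

/-- Reduction `ℤ₂ˣ → (ℤ/4)ˣ`. -/
def unitsMod4 : ℤ_[2]ˣ →* (ZMod 4)ˣ :=
  Units.map (PadicInt.toZModPow 2 : ℤ_[2] →+* ZMod 4).toMonoidHom

/-- There are isomorphisms between `ℂ` and the algebraic closure of `ℚ₂`. -/
theorem nonempty_ringEquiv : Nonempty (ℂ ≃+* AlgebraicClosure ℚ_[2]) := by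
  have h1 : Cardinal.continuum ≤ Cardinal.mk ℚ_[2] :=
    continuum_le_cardinal_of_nontriviallyNormedField ℚ_[2]
  have h2 : Cardinal.mk ℚ_[2] ≤ Cardinal.continuum := by
    have a1 : Cardinal.mk ℚ_[2] ≤ Cardinal.mk (PadicSeq 2) := Cardinal.mk_quotient_le
    have a2 : Cardinal.mk (PadicSeq 2) ≤ Cardinal.mk (ℕ → ℚ) := Cardinal.mk_subtype_le _
    have a3 : Cardinal.mk (ℕ → ℚ) = Cardinal.continuum := by simp
    exact a1.trans (a2.trans a3.le)
  have h3 : Cardinal.mk (AlgebraicClosure ℚ_[2]) = Cardinal.continuum := by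
    apply le_antisymm
    · refine (Algebra.IsAlgebraic.cardinalMk_le_max ℚ_[2] (AlgebraicClosure ℚ_[2])).trans ?_
      exact max_le h2 Cardinal.aleph0_le_continuum
    · exact h1.trans (Cardinal.mk_le_of_injective
        (algebraMap ℚ_[2] (AlgebraicClosure ℚ_[2])).injective)
  have : CharZero (AlgebraicClosure ℚ_[2]) :=
    charZero_of_injective_algebraMap (algebraMap ℚ_[2] (AlgebraicClosure ℚ_[2])).injective
  refine IsAlgClosed.ringEquiv_of_equiv_of_charZero ?_ ?_
  · rw [Cardinal.mk_complex]
    exact Cardinal.aleph0_lt_continuum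
  · exact Cardinal.eq.mp (Cardinal.mk_complex.trans h3.symm)

end Quaternion

end RelK

end

/-! The groups $G$ in question have exponent two. Hence $\mathbf Q_2[G]$ is a product of copies of
$\mathbf Q_2$ indexed by the $\pm1$-valued characters (`signEquiv`), and $R(G)$ is generated by
these characters (`RepGroup.closure_ofChar`). So $u \mapsto \mathrm{Det}(u)$ identifies $\mathbf
Q_2[G]^*$ with $\mathrm{Hom}(R(G), \mathbf Q_2^*)$ (`detQEquiv`).

Write $R = \mathbf Z_2[G]$ and $S = \mathbf Q_2[G]$. The ring $R$ is local
(`isLocalRing_intGroupRing`), so projectives are free and a triple has a determinant in $S^*/R^*$,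
multiplicative on short exact sequences (`K0Rel.det`). In the other direction, $u \mapsto [R, u, R]$
is onto: a homomorphism from $GL_n$ over a product of fields of characteristic $\ne 2$ to a
commutative group kills transvections (`gl_hom_ext`), whence $[R^n, M, R^n] = [R, \det M, R]$
(`K0Rel.cls_ofGL`). Therefore $K_0(R; \mathbf Q_2) \cong S^*/R^*$, which is the Hom-description
(`exists_homDescription`).

It remains to compute $\mathrm{Det}(R^*)$. By Fourier inversion, values $a_\chi \in \mathbf Z_2$
come from $R$ as soon as $|G|$ divides every $\sum_\chi \chi(g) a_\chi$ (`exists_evalSign_eq`);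
since $R$ is local, the element is a unit once $a_1$ is. For $|G| \le 2$ and unit values the
congruence is automatic (`detUnits_eq_homZ`). For $Q_8^{ab}$ units are $\pm1$ modulo 4, and a sum of
four signs vanishes modulo 4 exactly when their product is 1; so the only condition on unit values
is that their product, the value at $s$, be 1 modulo 4 (`ker_valuationUnitPart`).

Induction is $f \mapsto f \circ \mathrm{Res}$ (`ind_ofHomQ`). For $|H| \le 2$ a nontrivial character
of $Q_8^{ab}$ is trivial on $H$, so $\mathrm{Res}(s) = 2r$ and $f(\mathrm{Res}(s)) = f(r)^2$; the
square of a unit is 1 modulo 4. -/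

noncomputable section

namespace RelK

/-! ### Homomorphisms from general linear groups to commutative groups -/

section GeneralLinear

variable {n : Type*} [Fintype n] [DecidableEq n]

/-- The invertible diagonal matrix with the given diagonal entries. -/
def glDiagonal {S : Type*} [CommRing S] (D : n → Sˣ) : Matrix.GeneralLinearGroup n S where
  val := Matrix.diagonal fun i => (D i : S)
  inv := Matrix.diagonal fun i => ((D i)⁻¹ : Sˣ)
  val_inv := by simp
  inv_val := by simp

/-- Conjugation by the diagonal matrix with entry 2 at `t.i` and 1 elsewhere doubles the
off-diagonal entry, so it sends `u` to `u * u`. In a commutative target conjugation is invisible,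
hence `f u = f u * f u`. -/
theorem map_eq_one_of_transvection {K : Type*} [Field K] (h2 : (2 : K) ≠ 0)
    {A : Type*} [CommGroup A] (f : Matrix.GeneralLinearGroup n K →* A)
    (t : Matrix.TransvectionStruct n K) (u : Matrix.GeneralLinearGroup n K)
    (hu : (u : Matrix n n K) = t.toMatrix) : f u = 1 := by
  have key : glDiagonal (Pi.mulSingle t.i (Units.mk0 2 h2)) * u =
      u * u * glDiagonal (Pi.mulSingle t.i (Units.mk0 2 h2)) := by
    have hd : (fun k => ((Pi.mulSingle t.i (Units.mk0 2 h2) : n → Kˣ) k : K)) t.j = 1 := by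
      simp [Pi.mulSingle_eq_of_ne t.hij.symm]
    ext a b
    simp only [Units.val_mul, hu, Matrix.TransvectionStruct.toMatrix,
      Matrix.transvection_mul_transvection_same _ _ t.hij, glDiagonal, Matrix.diagonal_mul,
      Matrix.mul_diagonal]
    simp only [Matrix.transvection, Matrix.add_apply, Matrix.one_apply, Matrix.single_apply]
    by_cases ha : t.i = a
    · subst ha
      by_cases hb : t.j = b
      · subst hb
        simp only [hd, t.hij, if_false, and_self, if_true, Pi.mulSingle_eq_same, Units.val_mk0]
        ring
      · by_cases hab : t.i = b
        · subst hab
          simp [hb]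
        · simp [hb, hab]
    · by_cases hab : a = b
      · subst hab
        simp [ha]
      · simp [ha, hab]
  have h := congrArg f key
  simp only [map_mul] at h
  rw [mul_comm] at h
  have h' := mul_right_cancel h
  exact (mul_eq_left.mp h'.symm)

/-- Over a field of characteristic different from two, a homomorphism from `GLₙ` to a commutative
group is determined by its values on diagonal matrices. -/
theorem gl_hom_ext_of_field {K : Type*} [Field K] (h2 : (2 : K) ≠ 0)
    {A : Type*} [CommGroup A] (f g : Matrix.GeneralLinearGroup n K →* A)
    (hfg : ∀ D, f (glDiagonal D) = g (glDiagonal D)) : f = g := by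
  ext u
  have hu : (u : Matrix n n K).det ≠ 0 := by
    have := u.isUnit.map Matrix.detMonoidHom
    exact this.ne_zero
  -- The induction runs over matrices while `f` and `g` take units; quantifying over all units with
  -- underlying matrix `M` reconciles the two.
  refine Matrix.diagonal_transvection_induction_of_det_ne_zero
    (fun M => ∀ v : Matrix.GeneralLinearGroup n K, (v : Matrix n n K) = M → f v = g v)
    (u : Matrix n n K) hu ?_ ?_ ?_ u rfl
  · intro D hD v hv
    rw [Matrix.det_diagonal, Finset.prod_ne_zero_iff] at hD
    have : v = glDiagonal fun i => Units.mk0 (D i) (hD i (Finset.mem_univ i)) := by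
      apply Units.ext
      rw [hv]
      rfl
    rw [this, hfg]
  · intro t v hv
    rw [map_eq_one_of_transvection h2 f t v hv, map_eq_one_of_transvection h2 g t v hv]
  · intro M N hM hN ihM ihN v hv
    have hM' : IsUnit M := (Matrix.isUnit_iff_isUnit_det M).mpr hM.isUnit
    have hN' : IsUnit N := (Matrix.isUnit_iff_isUnit_det N).mpr hN.isUnit
    have : v = hM'.unit * hN'.unit := Units.ext hv
    rw [this, map_mul, map_mul, ihM _ rfl, ihN _ rfl]

/-- `GLₙ` of a finite product of copies of `K` is the product of copies of `GLₙ(K)`. -/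
def glProd {S K I : Type*} [CommRing S] [Field K] (e : S ≃+* (I → K)) :
    Matrix.GeneralLinearGroup n S ≃* (I → Matrix.GeneralLinearGroup n K) where
  toFun M i := Matrix.GeneralLinearGroup.map ((Pi.evalRingHom (fun _ : I => K) i).comp
    (e : S →+* (I → K))) M
  invFun N :=
    { val := Matrix.of fun a b => e.symm fun i => (N i : Matrix n n K) a b
      inv := Matrix.of fun a b => e.symm fun i => (((N i)⁻¹ : Matrix.GeneralLinearGroup n K) :
        Matrix n n K) a b
      val_inv := by
        ext a b
        apply e.injective
        funext i
        have h := congrFun (congrFun (N i).val_inv a) b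
        simp only [Matrix.mul_apply] at h
        simp only [Matrix.mul_apply, map_sum, Finset.sum_apply, Matrix.of_apply, map_mul,
          Pi.mul_apply, RingEquiv.apply_symm_apply]
        refine h.trans ?_
        simp only [Matrix.one_apply]
        split_ifs <;> simp
      inv_val := by
        ext a b
        apply e.injective
        funext i
        have h := congrFun (congrFun (N i).inv_val a) b
        simp only [Matrix.mul_apply] at h
        simp only [Matrix.mul_apply, map_sum, Finset.sum_apply, Matrix.of_apply, map_mul,
          Pi.mul_apply, RingEquiv.apply_symm_apply]
        refine h.trans ?_
        simp only [Matrix.one_apply]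
        split_ifs <;> simp }
  left_inv M := by
    ext a b
    apply e.injective
    funext i
    simp
  right_inv N := by
    funext i
    ext a b
    simp
  map_mul' M N := by
    funext i
    simp only [map_mul, Pi.mul_apply]

/-- If `S` is a finite product of copies of a field of characteristic different from two, then a
homomorphism from `GLₙ(S)` to a commutative group is determined by its values on diagonal
matrices. -/
theorem gl_hom_ext {S K I : Type*} [CommRing S] [Field K] [Finite I] (e : S ≃+* (I → K))
    (h2 : (2 : K) ≠ 0) {A : Type*} [CommGroup A] (f g : Matrix.GeneralLinearGroup n S →* A)
    (hfg : ∀ D, f (glDiagonal D) = g (glDiagonal D)) : f = g := by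
  classical
  -- A homomorphism out of a finite product is determined on the factors, and a diagonal matrix
  -- placed in one factor is again diagonal over `S`, with 1 in the other coordinates.
  have h : f.comp (glProd e).symm.toMonoidHom = g.comp (glProd e).symm.toMonoidHom := by
    apply MonoidHom.pi_ext
    intro i x
    refine DFunLike.congr_fun (gl_hom_ext_of_field h2
      ((f.comp (glProd e).symm.toMonoidHom).comp (MonoidHom.mulSingle (fun _ => Matrix.GeneralLinearGroup n K) i))
      ((g.comp (glProd e).symm.toMonoidHom).comp (MonoidHom.mulSingle (fun _ => Matrix.GeneralLinearGroup n K) i)) fun D => ?_) x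
    have hD : (glProd (n := n) e).symm (Pi.mulSingle i (glDiagonal D)) =
        glDiagonal fun a => Units.map (e.symm : (I → K) →* S)
          (MulEquiv.piUnits.symm (Pi.mulSingle i (D a))) := by
      rw [MulEquiv.symm_apply_eq]
      funext j
      ext a b
      by_cases hj : j = i
      · subst hj
        by_cases hab : a = b
        · subst hab
          simp [glProd, glDiagonal]
        · simp [glProd, glDiagonal, hab]
      · by_cases hab : a = b
        · subst hab
          simp [glProd, glDiagonal, hj]
        · simp [glProd, glDiagonal, hab, hj]
    simp only [MonoidHom.comp_apply, MonoidHom.mulSingle_apply]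
    change f ((glProd e).symm _) = g ((glProd e).symm _)
    rw [hD, hfg]
  ext M
  have := DFunLike.congr_fun h (glProd e M)
  simpa using this

end GeneralLinear

/-! ### Elementary relations in `K₀(R; S)` -/

section K0Relations

variable {R S : Type} [CommRing R] [CommRing S] [Algebra R S]

theorem K0Rel.cls_of_exact {X Y Z : Triple R S} (h : X.IsShortExact Y Z) :
    K0Rel.cls Y = K0Rel.cls X + K0Rel.cls Z := by
  have h0 := K0Rel.mk_eq_zero R S (Triple.Relation.exact X Y Z h)
  rw [map_sub, map_sub, sub_sub, sub_eq_zero] at h0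
  exact h0

theorem K0Rel.cls_trans (A B C : Type) [AddCommGroup A] [AddCommGroup B] [AddCommGroup C]
    [Module R A] [Module R B] [Module R C]
    [Module.Finite R A] [Module.Finite R B] [Module.Finite R C]
    [Module.Projective R A] [Module.Projective R B] [Module.Projective R C]
    (φ : S ⊗[R] A ≃ₗ[S] S ⊗[R] B) (ψ : S ⊗[R] B ≃ₗ[S] S ⊗[R] C) :
    K0Rel.cls (Triple.mk A C (φ.trans ψ)) =
      K0Rel.cls (Triple.mk A B φ) + K0Rel.cls (Triple.mk B C ψ) := by
  have h0 := K0Rel.mk_eq_zero R S (Triple.Relation.comp A B C φ ψ)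
  rw [map_sub, map_sub, sub_sub, sub_eq_zero] at h0
  exact h0

theorem K0Rel.cls_refl (A : Type) [AddCommGroup A] [Module R A] [Module.Finite R A]
    [Module.Projective R A] :
    K0Rel.cls (Triple.mk A A (LinearEquiv.refl S (S ⊗[R] A))) = 0 := by
  have h := K0Rel.cls_trans A A A (LinearEquiv.refl S (S ⊗[R] A)) (LinearEquiv.refl S (S ⊗[R] A))
  rw [LinearEquiv.refl_trans] at h
  exact left_eq_add.mp h

/-- Isomorphic triples have the same class. -/
theorem K0Rel.cls_congr (X Y : Triple R S) (e : X.A ≃ₗ[R] Y.A) (f : X.B ≃ₗ[R] Y.B)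
    (h : Y.φ.toLinearMap ∘ₗ e.toLinearMap.baseChange S =
      f.toLinearMap.baseChange S ∘ₗ X.φ.toLinearMap) :
    K0Rel.cls X = K0Rel.cls Y := by
  -- An isomorphism of triples is a short exact sequence whose third term is the zero triple.
  have hex : X.IsShortExact Y (Triple.mk PUnit PUnit (LinearEquiv.refl S (S ⊗[R] PUnit))) := by
    refine ⟨e, 0, f, 0, e.injective, ?_, fun _ => ⟨0, rfl⟩, f.injective, ?_, fun _ => ⟨0, rfl⟩,
      h, ?_⟩
    · exact fun y => ⟨fun _ => e.surjective y, fun _ => rfl⟩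
    · exact fun y => ⟨fun _ => f.surjective y, fun _ => rfl⟩
    · simp
  rw [K0Rel.cls_of_exact hex, K0Rel.cls_refl, add_zero]

/-- The pair $(\mathrm{id}, e)$ is an isomorphism from the identity triple on `A` to this one. -/
theorem K0Rel.cls_baseChange {A B : Type} [AddCommGroup A] [AddCommGroup B]
    [Module R A] [Module R B] [Module.Finite R A] [Module.Finite R B]
    [Module.Projective R A] [Module.Projective R B] (e : A ≃ₗ[R] B) :
    K0Rel.cls (Triple.mk A B (LinearEquiv.baseChange R S A B e)) = 0 := by
  rw [← K0Rel.cls_refl (S := S) A]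
  refine (K0Rel.cls_congr _ _ (LinearEquiv.refl R A) e ?_).symm
  apply TensorProduct.AlgebraTensorModule.curry_injective
  ext a
  simp

variable (R S) in
/-- The homomorphism `Sˣ → K₀(R; S)`, `a ↦ [R, a, R]`. -/
def K0Rel.ofUnit : Additive Sˣ →+ K0Rel R S where
  toFun a := K0Rel.cls (Triple.mk R R (LinearEquiv.smulOfUnit a.toMul))
  map_zero' := by
    rw [← K0Rel.cls_refl (S := S) R]
    congr 2
    ext x
    simp [LinearEquiv.smulOfUnit]
  map_add' a b := by
    rw [← K0Rel.cls_trans]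
    congr 2
    ext x
    change ((a.toMul * b.toMul : Sˣ) : S) • x = (b.toMul : S) • (a.toMul : S) • x
    rw [smul_smul, Units.val_mul, mul_comm]

theorem K0Rel.ofUnit_algebraMap (r : Rˣ) :
    K0Rel.ofUnit R S (Additive.ofMul (Units.map (algebraMap R S).toMonoidHom r)) = 0 := by
  rw [← K0Rel.cls_baseChange (S := S) (LinearEquiv.smulOfUnit (M := R) r)]
  change K0Rel.cls _ = _
  congr 2
  apply LinearEquiv.toLinearMap_injective
  apply TensorProduct.AlgebraTensorModule.curry_injective
  ext
  simp [LinearEquiv.smulOfUnit, Units.smul_def, TensorProduct.smul_tmul', Algebra.algebraMap_eq_smul_one]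
  try rw [TensorProduct.smul_tmul]; simp

variable (R) in
/-- The automorphism of `S ⊗ Rⁿ` given by an invertible matrix over `S`. -/
def glIso {n : ℕ} (M : Matrix.GeneralLinearGroup (Fin n) S) :
    S ⊗[R] (Fin n → R) ≃ₗ[S] S ⊗[R] (Fin n → R) :=
  Matrix.toLinearEquiv (Algebra.TensorProduct.basis S (Pi.basisFun R (Fin n))) M.1
    ((Matrix.isUnit_iff_isUnit_det _).mp M.isUnit)

theorem glIso_single {n : ℕ} (M : Matrix.GeneralLinearGroup (Fin n) S) (k : Fin n) :
    glIso R M ((1 : S) ⊗ₜ[R] (Pi.single k (1 : R))) =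
      ∑ j, M.1 j k • ((1 : S) ⊗ₜ[R] (Pi.single j (1 : R) : Fin n → R)) := by
  have h := Matrix.toLin_self (Algebra.TensorProduct.basis S (Pi.basisFun R (Fin n)))
    (Algebra.TensorProduct.basis S (Pi.basisFun R (Fin n))) M.1 k
  simp only [Algebra.TensorProduct.basis_apply, Pi.basisFun_apply] at h
  exact h

theorem glIso_diagonal {n : ℕ} (D : Fin n → Sˣ) (k : Fin n) :
    glIso R (glDiagonal D) ((1 : S) ⊗ₜ[R] (Pi.single k (1 : R))) =
      (D k : S) • ((1 : S) ⊗ₜ[R] (Pi.single k (1 : R) : Fin n → R)) := by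
  rw [glIso_single, Finset.sum_eq_single k]
  · simp [glDiagonal]
  · intro b _ hb
    simp [glDiagonal, hb]
  · simp

/-- Together with `funLeft_comp_glIso_diagonal`, this makes $0 \to R \to R^{n+1} \to R^n \to 0$ a
sequence of triples, with `D 0` acting on the submodule and `Fin.tail D` on the quotient. -/
theorem glIso_diagonal_comp_single {n : ℕ} (D : Fin (n + 1) → Sˣ) :
    (glIso R (glDiagonal D)).toLinearMap ∘ₗ
        (LinearMap.single R (fun _ : Fin (n + 1) => R) 0).baseChange S =
      (LinearMap.single R (fun _ : Fin (n + 1) => R) 0).baseChange S ∘ₗ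
        (LinearEquiv.smulOfUnit (M := S ⊗[R] R) (D 0)).toLinearMap := by
  apply TensorProduct.AlgebraTensorModule.curry_injective
  ext
  simp [glIso_diagonal, LinearEquiv.smulOfUnit, Units.smul_def, TensorProduct.smul_tmul']

theorem funLeft_comp_glIso_diagonal {n : ℕ} (D : Fin (n + 1) → Sˣ) :
    (glIso R (glDiagonal (Fin.tail D))).toLinearMap ∘ₗ
        (LinearMap.funLeft R R (Fin.succ (n := n))).baseChange S =
      (LinearMap.funLeft R R (Fin.succ (n := n))).baseChange S ∘ₗ
        (glIso R (glDiagonal D)).toLinearMap := by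
  refine (Algebra.TensorProduct.basis S (Pi.basisFun R (Fin (n + 1)))).ext fun k => ?_
  simp only [Algebra.TensorProduct.basis_apply, Pi.basisFun_apply, LinearMap.comp_apply,
    LinearMap.baseChange_tmul, LinearEquiv.coe_coe, glIso_diagonal, map_smul]
  refine Fin.cases ?_ (fun j => ?_) k
  · have : LinearMap.funLeft R R (Fin.succ (n := n)) (Pi.single 0 1) = 0 := by
      ext l
      simp [LinearMap.funLeft]
    rw [this]
    simp
  · have : LinearMap.funLeft R R (Fin.succ (n := n)) (Pi.single j.succ 1) = Pi.single j 1 := by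
      ext l
      simp [LinearMap.funLeft, Pi.single_apply]
    rw [this, glIso_diagonal]
    rfl

/-- The triple `[Rⁿ, M, Rⁿ]` for an invertible matrix `M` over `S`. -/
def Triple.ofGL {n : ℕ} (M : Matrix.GeneralLinearGroup (Fin n) S) : Triple R S :=
  Triple.mk (Fin n → R) (Fin n → R) (glIso R M)

variable (R S) in
/-- The homomorphism `GLₙ(S) → K₀(R; S)`, `M ↦ [Rⁿ, M, Rⁿ]`. -/
def K0Rel.ofGL (n : ℕ) : Matrix.GeneralLinearGroup (Fin n) S →* Multiplicative (K0Rel R S) where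
  toFun M := Multiplicative.ofAdd (K0Rel.cls (Triple.ofGL M))
  map_one' := by
    rw [← ofAdd_zero, ← K0Rel.cls_refl (S := S) (Fin n → R)]
    congr 2
    rw [Triple.ofGL]
    congr 1
    ext x
    simp [glIso, Matrix.toLinearEquiv_apply]
  map_mul' M N := by
    -- The product `M * N` applies `N` first, whereas `trans` lists the first map first; the order
    -- is swapped in the commutative target.
    rw [← ofAdd_add, add_comm, Triple.ofGL, Triple.ofGL, Triple.ofGL, ← K0Rel.cls_trans]
    congr 3
    ext x
    simp [glIso, Matrix.toLinearEquiv_apply, 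
      Matrix.toLin_mul _ (Algebra.TensorProduct.basis S (Pi.basisFun R (Fin n)))]

theorem K0Rel.cls_ofGL_diagonal {n : ℕ} (D : Fin n → Sˣ) :
    K0Rel.cls (Triple.ofGL (R := R) (glDiagonal D)) =
      K0Rel.ofUnit R S (Additive.ofMul (∏ i, D i)) := by
  induction n with
  | zero =>
    have : glDiagonal D = 1 := by
      ext i
      exact i.elim0
    rw [this]
    have := map_one (K0Rel.ofGL R S 0)
    rw [Finset.univ_eq_empty, Finset.prod_empty, ofMul_one, map_zero]
    exact this
  | succ n ih =>
    have hex : (Triple.mk R R (LinearEquiv.smulOfUnit (D 0))).IsShortExact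
        (Triple.ofGL (R := R) (glDiagonal D)) (Triple.ofGL (R := R) (glDiagonal (Fin.tail D))) := by
      have hi : Function.Injective (LinearMap.single R (fun _ : Fin (n + 1) => R) 0) :=
        Pi.single_injective (M := fun _ : Fin (n + 1) => R) 0
      have hp : Function.Surjective (LinearMap.funLeft R R (Fin.succ (n := n))) :=
        LinearMap.funLeft_surjective_of_injective _ _ _ (Fin.succ_injective n)
      have he : Function.Exact (LinearMap.single R (fun _ : Fin (n + 1) => R) 0)
          (LinearMap.funLeft R R (Fin.succ (n := n))) := by
        intro y
        constructor
        · intro h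
          refine ⟨y 0, ?_⟩
          ext i
          refine Fin.cases ?_ (fun j => ?_) i
          · simp
          · simpa using (congrFun h j).symm
        · rintro ⟨x, rfl⟩
          ext j
          simp [LinearMap.funLeft]
      exact ⟨_, _, _, _, hi, he, hp, hi, he, hp, glIso_diagonal_comp_single D,
        funLeft_comp_glIso_diagonal D⟩
    rw [K0Rel.cls_of_exact hex, ih, Fin.prod_univ_succ, ofMul_mul, map_add]
    rfl

/-- If `S` is a finite product of copies of a field of characteristic different from two, then
`[Rⁿ, M, Rⁿ] = [R, det M, R]`. -/
theorem K0Rel.cls_ofGL {K I : Type*} [Field K] [Finite I] (e : S ≃+* (I → K)) (h2 : (2 : K) ≠ 0)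
    {n : ℕ} (M : Matrix.GeneralLinearGroup (Fin n) S) :
    K0Rel.cls (Triple.ofGL (R := R) M) =
      K0Rel.ofUnit R S (Additive.ofMul (Matrix.GeneralLinearGroup.det M)) := by
  -- Both sides are homomorphisms from $GL_n(S)$ to a commutative group, so diagonal matrices
  -- suffice.
  have h := gl_hom_ext e h2 (K0Rel.ofGL R S n)
    ((AddMonoidHom.toMultiplicativeRight (K0Rel.ofUnit R S)).comp Matrix.GeneralLinearGroup.det)
    fun D => by
      have hD : Matrix.GeneralLinearGroup.det (glDiagonal D) = ∏ i, D i := by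
        apply Units.ext
        simp [glDiagonal, Matrix.GeneralLinearGroup.det]
      rw [MonoidHom.comp_apply, hD]
      exact congrArg Multiplicative.ofAdd (K0Rel.cls_ofGL_diagonal D)
  exact congrArg Multiplicative.toAdd (DFunLike.congr_fun h M)

end K0Relations

/-! ### Determinants of maps between short exact sequences -/

/-- In bases adapted to two short exact sequences, the determinant of a map of short exact sequences
is the product of the outer determinants. -/
theorem det_toMatrix_of_exact {S m n : Type*} [CommRing S] [Fintype m] [Fintype n] [DecidableEq m]
    [DecidableEq n] {M₁ M₂ M₃ N₁ N₂ N₃ : Type*}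
    [AddCommGroup M₁] [AddCommGroup M₂] [AddCommGroup M₃]
    [AddCommGroup N₁] [AddCommGroup N₂] [AddCommGroup N₃]
    [Module S M₁] [Module S M₂] [Module S M₃] [Module S N₁] [Module S N₂] [Module S N₃]
    {i : M₁ →ₗ[S] M₂} {p : M₂ →ₗ[S] M₃} {j : N₁ →ₗ[S] N₂} {q : N₂ →ₗ[S] N₃}
    (hjq : ∀ x, q (j x) = 0)
    {f₁ : M₁ →ₗ[S] N₁} {f₂ : M₂ →ₗ[S] N₂} {f₃ : M₃ →ₗ[S] N₃}
    (h₁ : ∀ x, f₂ (i x) = j (f₁ x)) (h₂ : ∀ x, f₃ (p x) = q (f₂ x))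
    (b₁ : Module.Basis m S M₁) (b₂ : Module.Basis (m ⊕ n) S M₂) (b₃ : Module.Basis n S M₃)
    (c₁ : Module.Basis m S N₁) (c₂ : Module.Basis (m ⊕ n) S N₂) (c₃ : Module.Basis n S N₃)
    (hb₁ : ∀ k, b₂ (Sum.inl k) = i (b₁ k)) (hb₃ : ∀ k, p (b₂ (Sum.inr k)) = b₃ k)
    (hc₁ : ∀ k, c₂ (Sum.inl k) = j (c₁ k)) (hc₃ : ∀ k, q (c₂ (Sum.inr k)) = c₃ k) :
    (LinearMap.toMatrix b₂ c₂ f₂).det =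
      (LinearMap.toMatrix b₁ c₁ f₁).det * (LinearMap.toMatrix b₃ c₃ f₃).det := by
  have hj : ∀ x, c₂.repr (j x) = (c₁.repr x).mapDomain Sum.inl := by
    intro x
    have : c₂.repr.toLinearMap ∘ₗ j =
        Finsupp.lmapDomain S S Sum.inl ∘ₗ c₁.repr.toLinearMap := by
      refine c₁.ext fun k => ?_
      simp [← hc₁]
    exact LinearMap.congr_fun this x
  have hq : ∀ y k, c₃.repr (q y) k = c₂.repr y (Sum.inr k) := by
    intro y k
    have : Finsupp.lapply k ∘ₗ c₃.repr.toLinearMap ∘ₗ q =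
        Finsupp.lapply (Sum.inr k) ∘ₗ c₂.repr.toLinearMap := by
      refine c₂.ext fun l => ?_
      cases l with
      | inl l => simp [hc₁, hjq, hj]
      | inr l => simp [hc₃, Finsupp.single_apply]
    exact LinearMap.congr_fun this y
  -- Since `f₂` carries the image of `i` into that of `j`, the lower left block vanishes.
  have hblock : LinearMap.toMatrix b₂ c₂ f₂ =
      Matrix.fromBlocks (LinearMap.toMatrix b₁ c₁ f₁)
        (LinearMap.toMatrix b₂ c₂ f₂).toBlocks₁₂ 0 (LinearMap.toMatrix b₃ c₃ f₃) := by
    rw [← Matrix.fromBlocks_toBlocks (LinearMap.toMatrix b₂ c₂ f₂)]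
    congr 1
    · ext k l
      simp only [Matrix.toBlocks₁₁, Matrix.of_apply, LinearMap.toMatrix_apply, hb₁, h₁, hj]
      rw [Finsupp.mapDomain_apply Sum.inl_injective]
    · ext k l
      simp only [Matrix.toBlocks₂₁, Matrix.of_apply, LinearMap.toMatrix_apply, hb₁, h₁, hj]
      rw [Finsupp.mapDomain_of_notMem_range _ _ (by simp)]
      rfl
    · ext k l
      simp only [Matrix.toBlocks₂₂, Matrix.of_apply, LinearMap.toMatrix_apply, ← hb₃, h₂, hq]
  rw [hblock, Matrix.det_fromBlocks_zero₂₁]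

/-- A basis of the middle term of a split short exact sequence adapted to bases of the outer
terms. -/
theorem exists_adapted_basis {R m n M₁ M₂ M₃ : Type*} [CommRing R]
    [AddCommGroup M₁] [AddCommGroup M₂] [AddCommGroup M₃]
    [Module R M₁] [Module R M₂] [Module R M₃] [Module.Projective R M₃]
    {i : M₁ →ₗ[R] M₂} {p : M₂ →ₗ[R] M₃} (hi : Function.Injective i) (hip : Function.Exact i p)
    (hp : Function.Surjective p) (b₁ : Module.Basis m R M₁) (b₃ : Module.Basis n R M₃) :
    ∃ b₂ : Module.Basis (m ⊕ n) R M₂,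
      (∀ k, b₂ (Sum.inl k) = i (b₁ k)) ∧ ∀ k, p (b₂ (Sum.inr k)) = b₃ k := by
  obtain ⟨l, hl⟩ := Module.projective_lifting_property p LinearMap.id hp
  obtain ⟨e, rfl, rfl⟩ := ((hip.split_tfae hi hp).out 0 2 rfl rfl).mp ⟨l, hl⟩
  exact ⟨(b₁.prod b₃).map e.symm, by simp, by simp⟩

/-! ### The determinant on $K_0(R; S)$ and the kernel of $S^* \to K_0(R; S)$ -/

section RelDet

variable {R S : Type} [CommRing R] [CommRing S] [Algebra R S]

variable (R S) in
/-- The image of `Rˣ` in `Sˣ`. -/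
abbrev unitsRange : Subgroup Sˣ := (Units.map (algebraMap R S).toMonoidHom).range

/-- The determinant of an isomorphism `S ⊗ A ≅ S ⊗ B` with respect to bases of `A` and `B`. -/
def relDet {ι A B : Type*} [Fintype ι] [DecidableEq ι] [AddCommGroup A] [AddCommGroup B]
    [Module R A] [Module R B] (φ : S ⊗[R] A ≃ₗ[S] S ⊗[R] B)
    (x : Module.Basis ι R A) (y : Module.Basis ι R B) : Sˣ :=
  (LinearEquiv.isUnit_det φ (Algebra.TensorProduct.basis S x)
    (Algebra.TensorProduct.basis S y)).unit

theorem coe_relDet {ι A B : Type*} [Fintype ι] [DecidableEq ι] [AddCommGroup A] [AddCommGroup B]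
    [Module R A] [Module R B] (φ : S ⊗[R] A ≃ₗ[S] S ⊗[R] B)
    (x : Module.Basis ι R A) (y : Module.Basis ι R B) :
    (relDet φ x y : S) = (LinearMap.toMatrix (Algebra.TensorProduct.basis S x)
      (Algebra.TensorProduct.basis S y) φ.toLinearMap).det := rfl

theorem relDet_trans {ι A B C : Type*} [Fintype ι] [DecidableEq ι] [AddCommGroup A]
    [AddCommGroup B] [AddCommGroup C] [Module R A] [Module R B] [Module R C]
    (φ : S ⊗[R] A ≃ₗ[S] S ⊗[R] B) (ψ : S ⊗[R] B ≃ₗ[S] S ⊗[R] C)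
    (x : Module.Basis ι R A) (y : Module.Basis ι R B) (z : Module.Basis ι R C) :
    relDet (φ.trans ψ) x z = relDet φ x y * relDet ψ y z := by
  apply Units.ext
  rw [Units.val_mul, coe_relDet, coe_relDet, coe_relDet, mul_comm, ← Matrix.det_mul,
    ← LinearMap.toMatrix_comp]
  rfl

/-- The change-of-basis matrix already has entries in `R`, and it is invertible there. -/
theorem relDet_refl_mem {ι A : Type*} [Fintype ι] [DecidableEq ι] [AddCommGroup A] [Module R A]
    (x x' : Module.Basis ι R A) :
    relDet (LinearEquiv.refl S (S ⊗[R] A)) x x' ∈ unitsRange R S := by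
  refine ⟨(LinearEquiv.isUnit_det (LinearEquiv.refl R A) x x').unit, Units.ext ?_⟩
  have h := LinearMap.toMatrix_baseChange S (LinearMap.id : A →ₗ[R] A) x x'
  rw [LinearMap.baseChange_id] at h
  rw [coe_relDet]
  refine Eq.trans ?_ (congrArg Matrix.det h).symm
  exact RingHom.map_det (algebraMap R S) _

theorem relDet_reindex {ι κ A B : Type*} [Fintype ι] [DecidableEq ι] [Fintype κ] [DecidableEq κ]
    [AddCommGroup A] [AddCommGroup B]
    [Module R A] [Module R B] (φ : S ⊗[R] A ≃ₗ[S] S ⊗[R] B)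
    (x : Module.Basis ι R A) (y : Module.Basis ι R B) (e : ι ≃ κ) :
    relDet φ (x.reindex e) (y.reindex e) = relDet φ x y := by
  apply Units.ext
  rw [coe_relDet, coe_relDet, ← Matrix.det_reindex_self e]
  congr 1
  ext k l
  simp only [LinearMap.toMatrix_apply, Matrix.reindex_apply, Matrix.submatrix_apply,
    Algebra.TensorProduct.basis_apply, Module.Basis.reindex_apply]
  have : Algebra.TensorProduct.basis S (y.reindex e) = (Algebra.TensorProduct.basis S y).reindex e :=
    Module.Basis.eq_of_apply_eq fun i => by simp
  rw [this]
  simp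

/-- Modulo `Rˣ`, the determinant does not depend on the bases. -/
theorem mk_relDet_eq [Nontrivial R] {ι κ A B : Type*} [Fintype ι] [DecidableEq ι] [Fintype κ]
    [DecidableEq κ]
    [AddCommGroup A] [AddCommGroup B] [Module R A] [Module R B] (φ : S ⊗[R] A ≃ₗ[S] S ⊗[R] B)
    (x : Module.Basis ι R A) (y : Module.Basis ι R B)
    (x' : Module.Basis κ R A) (y' : Module.Basis κ R B) :
    (relDet φ x y : Sˣ ⧸ unitsRange R S) = relDet φ x' y' := by
  -- Over a nontrivial ring two bases of `A` have equipotent index sets, so a common index set may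
  -- be assumed. Then `φ` is factored as $\mathrm{id} \circ φ \circ \mathrm{id}$, the identities
  -- contributing changes of basis over `R`.
  rw [← relDet_reindex φ x' y' (x'.indexEquiv x)]
  generalize x'.reindex (x'.indexEquiv x) = x''
  generalize y'.reindex (x'.indexEquiv x) = y''
  have h : φ = (LinearEquiv.refl S _).trans (φ.trans (LinearEquiv.refl S _)) := by ext; simp
  conv_lhs => rw [h, relDet_trans _ _ x x'' y, relDet_trans _ _ x'' y'' y]
  rw [QuotientGroup.eq, mul_left_comm, mul_inv, inv_mul_cancel_comm]
  exact inv_mem (mul_mem (relDet_refl_mem x x'') (relDet_refl_mem y'' y))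

/-- Finitely generated projectives over a local ring are free, and the ranks agree because they can
be read off over `S`. -/
theorem Triple.exists_basis [IsLocalRing R] [Nontrivial S] (T : Triple R S) :
    ∃ n : ℕ, Nonempty (Module.Basis (Fin n) R T.A) ∧ Nonempty (Module.Basis (Fin n) R T.B) := by
  have hA : Module.Free R T.A := Module.free_of_flat_of_isLocalRing
  have hB : Module.Free R T.B := Module.free_of_flat_of_isLocalRing
  have h : Module.finrank R T.A = Module.finrank R T.B := by
    rw [← Module.finrank_baseChange (R := S), ← Module.finrank_baseChange (R := S) (M' := T.B)]
    exact T.φ.finrank_eq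
  exact ⟨_, ⟨Module.finBasis R T.A⟩, ⟨(Module.finBasis R T.B).reindex (finCongr h.symm)⟩⟩

variable {K I : Type*} [Field K] [Finite I]

/-- If `S` is a finite product of copies of a field of characteristic different from two, then
the class of a triple of free modules is the class of its determinant. -/
theorem K0Rel.cls_eq_ofUnit (e : S ≃+* (I → K)) (h2 : (2 : K) ≠ 0) (T : Triple R S) {n : ℕ}
    (x : Module.Basis (Fin n) R T.A) (y : Module.Basis (Fin n) R T.B) :
    K0Rel.cls T = K0Rel.ofUnit R S (Additive.ofMul (relDet T.φ x y)) := by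
  have hM := LinearEquiv.isUnit_det T.φ (Algebra.TensorProduct.basis S x)
    (Algebra.TensorProduct.basis S y)
  rw [← Matrix.isUnit_iff_isUnit_det] at hM
  have hdet : relDet T.φ x y = Matrix.GeneralLinearGroup.det hM.unit := Units.ext rfl
  rw [hdet, ← K0Rel.cls_ofGL e h2]
  refine K0Rel.cls_congr T _ x.equivFun y.equivFun ?_
  refine (Algebra.TensorProduct.basis S x).ext fun k => ?_
  have h1 : T.φ (1 ⊗ₜ x k) = ∑ j, hM.unit.1 j k • ((1 : S) ⊗ₜ[R] y j) := by
    have := (Matrix.toLin_self (Algebra.TensorProduct.basis S x)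
      (Algebra.TensorProduct.basis S y) hM.unit.1 k)
    simpa [Matrix.toLin_toMatrix] using this
  simp only [Algebra.TensorProduct.basis_apply]
  rw [LinearMap.comp_apply, LinearMap.comp_apply, LinearMap.baseChange_tmul]
  have h3 : (x.equivFun.toLinearMap (x k)) = Pi.single k 1 := by
    ext l
    simp [Pi.single_apply, eq_comm]
  erw [h3, glIso_single]
  change _ = LinearMap.baseChange S y.equivFun.toLinearMap (T.φ _)
  rw [h1, map_sum]
  refine Finset.sum_congr rfl fun j _ => ?_
  rw [map_smul, LinearMap.baseChange_tmul]
  congr 2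
  ext l
  simp [Pi.single_apply, eq_comm]

variable [IsLocalRing R] [Nontrivial S]

/-- The determinant of a triple in `Sˣ / Rˣ`. -/
def Triple.det (T : Triple R S) : Sˣ ⧸ unitsRange R S :=
  relDet T.φ T.exists_basis.choose_spec.1.some T.exists_basis.choose_spec.2.some

theorem Triple.det_eq {ι : Type*} [Fintype ι] [DecidableEq ι] (T : Triple R S)
    (x : Module.Basis ι R T.A) (y : Module.Basis ι R T.B) : T.det = relDet T.φ x y :=
  mk_relDet_eq _ _ _ _ _

/-- In bases adapted to the two sequences the matrix of the middle map is block triangular. -/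
theorem Triple.IsShortExact.det_eq {X Y Z : Triple R S} (h : X.IsShortExact Y Z) :
    Y.det = X.det * Z.det := by
  obtain ⟨i, p, j, q, h1, h2, h3, h4, h5, h6, h7, h8⟩ := h
  obtain ⟨m, ⟨b₁⟩, ⟨c₁⟩⟩ := X.exists_basis
  obtain ⟨n, ⟨b₃⟩, ⟨c₃⟩⟩ := Z.exists_basis
  obtain ⟨b₂, hb₁, hb₃⟩ := exists_adapted_basis h1 h2 h3 b₁ b₃
  obtain ⟨c₂, hc₁, hc₃⟩ := exists_adapted_basis h4 h5 h6 c₁ c₃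
  rw [X.det_eq b₁ c₁, Y.det_eq b₂ c₂, Z.det_eq b₃ c₃, ← QuotientGroup.mk_mul]
  congr 1
  apply Units.ext
  rw [Units.val_mul, coe_relDet, coe_relDet, coe_relDet]
  refine det_toMatrix_of_exact (i := i.baseChange S) (p := p.baseChange S) (j := j.baseChange S)
    (q := q.baseChange S) ?_ (LinearMap.congr_fun h7) (LinearMap.congr_fun h8) _ _ _ _ _ _ ?_ ?_
    ?_ ?_
  · have : q ∘ₗ j = 0 := h5.linearMap_comp_eq_zero
    intro x
    rw [← LinearMap.comp_apply, ← LinearMap.baseChange_comp, this, LinearMap.baseChange_zero,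
      LinearMap.zero_apply]
  · simp [hb₁]
  · simp [hb₃]
  · simp [hc₁]
  · simp [hc₃]

variable (R S) in
/-- The determinant `K₀(R; S) → Sˣ / Rˣ`. -/
def K0Rel.det : K0Rel R S →+ Additive (Sˣ ⧸ unitsRange R S) :=
  QuotientAddGroup.lift _ (FreeAbelianGroup.lift fun X : Triple R S => Additive.ofMul X.det) <| by
    rw [AddSubgroup.closure_le]
    intro x hx
    change FreeAbelianGroup.lift _ x = 0
    cases hx with
    | exact X Y Z h =>
      rw [map_sub, map_sub, FreeAbelianGroup.lift_apply_of, FreeAbelianGroup.lift_apply_of,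
        FreeAbelianGroup.lift_apply_of, h.det_eq, ofMul_mul]
      abel
    | comp A B C φ ψ =>
      obtain ⟨n, ⟨x⟩, ⟨y⟩⟩ := (Triple.mk A B φ).exists_basis
      obtain ⟨n', ⟨y'⟩, ⟨z'⟩⟩ := (Triple.mk B C ψ).exists_basis
      -- The basis `y` of `B` serves both triples, so the basis of `C` has to be reindexed from `Fin
      -- n'` to `Fin n`.
      have hz := z'.reindex (y'.indexEquiv y)
      rw [map_sub, map_sub, FreeAbelianGroup.lift_apply_of, FreeAbelianGroup.lift_apply_of,
        FreeAbelianGroup.lift_apply_of, (Triple.mk A B φ).det_eq x y, (Triple.mk B C ψ).det_eq y hz,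
        (Triple.mk A C (φ.trans ψ)).det_eq x hz, relDet_trans φ ψ x y hz, QuotientGroup.mk_mul,
        ofMul_mul]
      abel

theorem K0Rel.det_cls (T : Triple R S) : K0Rel.det R S (K0Rel.cls T) = Additive.ofMul T.det :=
  FreeAbelianGroup.lift_apply_of _ _

/-- Bounds the kernel of `K0Rel.ofUnit`: a unit whose class is zero must come from `R`. -/
theorem K0Rel.det_ofUnit (a : Sˣ) :
    K0Rel.det R S (K0Rel.ofUnit R S (Additive.ofMul a)) =
      Additive.ofMul (a : Sˣ ⧸ unitsRange R S) := by
  refine (K0Rel.det_cls _).trans (congrArg Additive.ofMul ?_)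
  rw [Triple.det_eq _ (Module.Basis.singleton Unit R) (Module.Basis.singleton Unit R)]
  congr 1
  apply Units.ext
  rw [coe_relDet, Matrix.det_unique, LinearMap.toMatrix_apply]
  simp [LinearEquiv.smulOfUnit, Units.smul_def]

/-- Triples generate, and each consists of free modules, so it is the class of its determinant by
`K0Rel.cls_eq_ofUnit`. -/
theorem K0Rel.ofUnit_surjective (e : S ≃+* (I → K)) (h2 : (2 : K) ≠ 0) :
    Function.Surjective (K0Rel.ofUnit R S) := by
  rw [← AddMonoidHom.range_eq_top, eq_top_iff]
  rintro z -
  obtain ⟨w, rfl⟩ := QuotientAddGroup.mk'_surjective _ z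
  change K0Rel.mk R S w ∈ _
  induction w using FreeAbelianGroup.induction_on with
  | zero => exact zero_mem _
  | neg T h => rw [map_neg]; exact neg_mem h
  | add x y hx hy => rw [map_add]; exact add_mem hx hy
  | of T =>
    obtain ⟨n, ⟨x⟩, ⟨y⟩⟩ := T.exists_basis
    exact ⟨_, (K0Rel.cls_eq_ofUnit e h2 T x y).symm⟩

/-- The kernel of `Sˣ → K₀(R; S)` is the image of `Rˣ`. -/
theorem K0Rel.ofUnit_eq_zero_iff (a : Sˣ) :
    K0Rel.ofUnit R S (Additive.ofMul a) = 0 ↔ a ∈ unitsRange R S := by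
  constructor
  · intro h
    have h' := (K0Rel.det_ofUnit (R := R) a).symm
    rw [h, map_zero] at h'
    exact (QuotientGroup.eq_one_iff _).mp (congrArg Additive.toMul h')
  · rintro ⟨r, rfl⟩
    exact K0Rel.ofUnit_algebraMap r

end RelDet

/-! ### Characters with values `±1` and group algebras of groups of exponent two -/

section SignCharacters

variable {G : Type} [CommGroup G]

/-- Evaluation of the elements of `k[G]` at a character with values `±1`. -/
def evalSign (k : Type) [CommRing k] (χ : G →* ℤˣ) : MonoidAlgebra k G →ₐ[k] k :=
  MonoidAlgebra.lift k k G
    ((Units.coeHom k).comp ((Units.map (Int.castRingHom k).toMonoidHom).comp χ))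

theorem evalSign_single (k : Type) [CommRing k] (χ : G →* ℤˣ) (g : G) (r : k) :
    evalSign k χ (MonoidAlgebra.single g r) = r * ((χ g : ℤ) : k) := by
  rw [evalSign, MonoidAlgebra.lift_single]
  rfl

theorem evalSign_mapRingHom {k l : Type} [CommRing k] [CommRing l] (f : k →+* l) (χ : G →* ℤˣ)
    (u : MonoidAlgebra k G) :
    evalSign l χ (MonoidAlgebra.mapRingHom G f u) = f (evalSign k χ u) := by
  induction u using MonoidAlgebra.induction_linear with
  | zero => simp
  | add x y hx hy => simp only [map_add, hx, hy]
  | single g r => simp [evalSign_single]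

/-- Orthogonality of characters: a sign character is its own inverse, so `χ * ψ` is nontrivial when
`χ ≠ ψ` and its values sum to zero. -/
theorem sum_signChar_mul (K : Type) [CommRing K] [Fintype G] (χ ψ : G →* ℤˣ) :
    ∑ g : G, (((χ g : ℤ) : K) * ((ψ g : ℤ) : K)) = if χ = ψ then (Fintype.card G : K) else 0 := by
  split_ifs with h
  · subst h
    have : ∀ g, (((χ g : ℤ) : K) * ((χ g : ℤ) : K)) = 1 := fun g => by
      rw [← Int.cast_mul, ← Units.val_mul, Int.units_mul_self]
      simp
    simp [this]
  · have h1 := sum_hom_units_eq_zero (R := ℤ) ((Units.coeHom ℤ).comp (χ * ψ)) fun h1 => h <| by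
      ext g
      have h2 := DFunLike.congr_fun h1 g
      have h3 : χ g * ψ g = 1 := Units.ext h2
      rw [eq_inv_of_mul_eq_one_left h3, Int.units_inv_eq_self]
    have h2 := congrArg (Int.cast : ℤ → K) h1
    simpa using h2

variable [Finite G]

instance : Finite (G →* ℤˣ) := Finite.of_injective _ DFunLike.coe_injective

/-- Since $-1 \in \mathbf Z$ is a primitive square root of unity, $\mathbf Z$ has enough roots of
unity for exponent two, and duality of finite abelian groups applies. -/
theorem card_signChar (hG : ∀ g : G, g ^ 2 = 1) : Nat.card (G →* ℤˣ) = Nat.card G := by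
  have h2 : HasEnoughRootsOfUnity ℤ 2 :=
    ⟨⟨-1, IsPrimitiveRoot.neg_one 0 (by decide)⟩, rootsOfUnity.isCyclic ℤ 2⟩
  have : HasEnoughRootsOfUnity ℤ (Monoid.exponent G) :=
    HasEnoughRootsOfUnity.of_dvd ℤ (Monoid.exponent_dvd_of_forall_pow_eq_one hG)
  exact CommGroup.card_monoidHom_of_hasEnoughRootsOfUnity G ℤ

variable (K : Type) [Field K] [CharZero K]

/-- The preimage of `a` is $\sum_\chi a_\chi e_\chi$ with the idempotents $e_\chi = |G|^{-1} \sum_g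
\chi(g) g$. -/
theorem evalSign_surjective :
    Function.Surjective (AlgHom.pi fun χ : G →* ℤˣ => evalSign K χ) := by
  classical
  have := Fintype.ofFinite G
  have := Fintype.ofFinite (G →* ℤˣ)
  intro a
  have hG : (Fintype.card G : K) ≠ 0 := Nat.cast_ne_zero.mpr Fintype.card_ne_zero
  refine ⟨∑ χ, (a χ / Fintype.card G) • ∑ g, MonoidAlgebra.single g ((χ g : ℤ) : K), ?_⟩
  funext ψ
  simp only [AlgHom.pi_apply, map_sum, map_smul, evalSign_single, sum_signChar_mul]
  simp [hG]

variable (G) in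
/-- For a group `G` of exponent two, `K[G]` is a product of copies of `K` indexed by the
characters with values `±1`. -/
def signEquiv (hG : ∀ g : G, g ^ 2 = 1) : MonoidAlgebra K G ≃ₐ[K] ((G →* ℤˣ) → K) :=
  AlgEquiv.ofBijective (AlgHom.pi fun χ : G →* ℤˣ => evalSign K χ) <| by
    have := Fintype.ofFinite G
    have := Fintype.ofFinite (G →* ℤˣ)
    refine ⟨?_, evalSign_surjective K⟩
    have hrank : Module.finrank K (MonoidAlgebra K G) = Module.finrank K ((G →* ℤˣ) → K) := by
      rw [(MonoidAlgebra.coeffLinearEquiv K).finrank_eq, Module.finrank_finsupp_self,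
        Module.finrank_fintype_fun_eq_card, ← Nat.card_eq_fintype_card, ← Nat.card_eq_fintype_card,
        card_signChar hG]
    exact (LinearMap.injective_iff_surjective_of_finrank_eq_finrank hrank (f :=
      (AlgHom.pi fun χ : G →* ℤˣ => evalSign K χ).toLinearMap)).mpr
      (evalSign_surjective K)

theorem signEquiv_apply (hG : ∀ g : G, g ^ 2 = 1) (u : MonoidAlgebra K G) (χ : G →* ℤˣ) :
    signEquiv G K hG u χ = evalSign K χ u := rfl

end SignCharacters

/-! ### Determinants of representations -/

section RepDet

variable (ι : ℂ ≃+* AlgebraicClosure ℚ_[2]) {G : Type}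

theorem RepGroup.cls_of_exact [Group G] {X Y Z : MatRep G} (h : X.IsShortExact Y Z) :
    RepGroup.cls Y = RepGroup.cls X + RepGroup.cls Z := by
  have h0 : RepGroup.mk G (FreeAbelianGroup.of Y - FreeAbelianGroup.of X -
      FreeAbelianGroup.of Z) = 0 :=
    (QuotientAddGroup.eq_zero_iff _).mpr (AddSubgroup.subset_closure ⟨X, Y, Z, h, rfl⟩)
  rw [map_sub, map_sub, sub_sub, sub_eq_zero] at h0
  exact h0

theorem evalRep_single [Group G] (X : MatRep G) (g : G) (r : ℚ_[2]) (a b : Fin X.dim) :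
    evalRep ι X (MonoidAlgebra.single g r) a b =
      algebraMap ℚ_[2] (AlgebraicClosure ℚ_[2]) r * ι (X.ρ g a b) := by
  rw [evalRep, MonoidAlgebra.lift_single, Matrix.smul_apply, Algebra.smul_def]
  rfl

/-- `evalRep` carried back to complex matrices. -/
def evalComplex [Group G] (X : MatRep G) :
    MonoidAlgebra ℚ_[2] G →+* Matrix (Fin X.dim) (Fin X.dim) ℂ :=
  ((ι.symm : AlgebraicClosure ℚ_[2] →+* ℂ).mapMatrix (m := Fin X.dim)).comp
    (evalRep ι X).toRingHom

theorem evalComplex_single [Group G] (X : MatRep G) (g : G) (r : ℚ_[2]) :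
    evalComplex ι X (MonoidAlgebra.single g r) =
      ι.symm (algebraMap ℚ_[2] (AlgebraicClosure ℚ_[2]) r) • X.ρ g := by
  ext a b
  simp [evalComplex, evalRep_single]

theorem det_evalRep [Group G] (X : MatRep G) (u : MonoidAlgebra ℚ_[2] G) :
    (evalRep ι X u).det = ι (evalComplex ι X u).det := by
  rw [evalComplex, RingHom.comp_apply, ← RingHom.map_det]
  simp

theorem evalComplex_comm [Group G] {X Y : MatRep G}
    (i : (Fin X.dim → ℂ) →ₗ[ℂ] (Fin Y.dim → ℂ))
    (hi : ∀ g v, i ((X.ρ g).mulVec v) = (Y.ρ g).mulVec (i v)) (u : MonoidAlgebra ℚ_[2] G)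
    (v : Fin X.dim → ℂ) :
    (evalComplex ι Y u).mulVec (i v) = i ((evalComplex ι X u).mulVec v) := by
  induction u using MonoidAlgebra.induction_linear with
  | zero => simp
  | add x y hx hy => simp only [map_add, Matrix.add_mulVec, hx, hy]
  | single g r => simp only [evalComplex_single, Matrix.smul_mulVec, map_smul, hi]

/-- The maps of the sequence are linear over $\mathbf C$, so the block triangular argument is
carried out there and transported by `ι`. -/
theorem MatRep.IsShortExact.det_evalRep [Group G] {X Y Z : MatRep G} (h : X.IsShortExact Y Z)
    (u : MonoidAlgebra ℚ_[2] G) :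
    (evalRep ι Y u).det = (evalRep ι X u).det * (evalRep ι Z u).det := by
  obtain ⟨i, p, h1, h2, h3, h4, h5⟩ := h
  obtain ⟨b, hb1, hb3⟩ := exists_adapted_basis h1 h2 h3 (Pi.basisFun ℂ _) (Pi.basisFun ℂ _)
  have key := det_toMatrix_of_exact (i := i) (p := p) (j := i) (q := p)
    (f₁ := Matrix.toLin' (evalComplex ι X u)) (f₂ := Matrix.toLin' (evalComplex ι Y u))
    (f₃ := Matrix.toLin' (evalComplex ι Z u)) h2.apply_apply_eq_zero
    (fun x => evalComplex_comm ι i h4 u x) (fun x => evalComplex_comm ι p h5 u x)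
    (Pi.basisFun ℂ _) b (Pi.basisFun ℂ _) (Pi.basisFun ℂ _) b (Pi.basisFun ℂ _) hb1 hb3 hb1 hb3
  simp only [LinearMap.det_toMatrix, LinearMap.det_toLin'] at key
  rw [RelK.det_evalRep, RelK.det_evalRep, RelK.det_evalRep, key, map_mul]

/-- The determinant of a unit of `ℚ₂[G]` as a function on `R(G)`. -/
def detRep [Group G] (u : (MonoidAlgebra ℚ_[2] G)ˣ) :
    RepGroup G →+ Additive (AlgebraicClosure ℚ_[2])ˣ :=
  QuotientAddGroup.lift _ (FreeAbelianGroup.lift fun X : MatRep G => Additive.ofMul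
    (Units.map (Matrix.detMonoidHom.comp (evalRep ι X).toRingHom.toMonoidHom) u)) <| by
    rw [MatRep.relations, AddSubgroup.closure_le]
    rintro _ ⟨X, Y, Z, h, rfl⟩
    change FreeAbelianGroup.lift _ _ = 0
    rw [map_sub, map_sub, FreeAbelianGroup.lift_apply_of, FreeAbelianGroup.lift_apply_of,
      FreeAbelianGroup.lift_apply_of, sub_sub, sub_eq_zero]
    exact congrArg Additive.ofMul (Units.ext (h.det_evalRep ι u))

theorem detRep_cls [Group G] (u : (MonoidAlgebra ℚ_[2] G)ˣ) (X : MatRep G) :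
    ((detRep ι u (RepGroup.cls X)).toMul : AlgebraicClosure ℚ_[2]) =
      (evalRep ι X u).det := by
  have := FreeAbelianGroup.lift_apply_of (fun X : MatRep G => Additive.ofMul
    (Units.map (Matrix.detMonoidHom.comp (evalRep ι X).toRingHom.toMonoidHom) u)) X
  exact congrArg (fun a : Additive (AlgebraicClosure ℚ_[2])ˣ => (a.toMul : AlgebraicClosure ℚ_[2]))
    this

/-- The blocks commute because $\mathbf Q_2[G]$ is commutative, so the determinant can be taken in
two stages; only $\det Φ$ matters. -/
theorem detAt_eq [CommGroup G] {n : ℕ} (Φ : Matrix (Fin n) (Fin n) (MonoidAlgebra ℚ_[2] G))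
    (X : MatRep G) : detAt ι Φ X = (evalRep ι X Φ.det).det :=
  (Matrix.det_det Φ (evalRep ι X).toRingHom).symm

/-- The complex character given by a character with values `±1`. -/
def complexChar [Group G] (χ : G →* ℤˣ) : G →* ℂˣ :=
  (Units.map (Int.castRingHom ℂ).toMonoidHom).comp χ

/-- The values of `χ` are integers, which `ι` fixes; so the determinant lies in $\mathbf Q_2$ and
does not depend on `ι`. -/
theorem detRep_ofChar [CommGroup G] (u : (MonoidAlgebra ℚ_[2] G)ˣ) (χ : G →* ℤˣ) :
    ((detRep ι u (RepGroup.ofChar (complexChar χ))).toMul : AlgebraicClosure ℚ_[2]) =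
      algebraMap ℚ_[2] _ (evalSign ℚ_[2] χ u) := by
  rw [RepGroup.ofChar, detRep_cls, Matrix.det_unique]
  generalize (u : MonoidAlgebra ℚ_[2] G) = v
  induction v using MonoidAlgebra.induction_linear with
  | zero => simp
  | add x y hx hy => simp only [map_add, Matrix.add_apply, hx, hy]
  | single g r =>
    refine (evalRep_single ι _ g r _ _).trans ?_
    rw [evalSign_single, map_mul]
    congr 1
    change ι ((Matrix.scalar (Fin 1) (((χ g : ℤ) : ℂ)) : Matrix (Fin 1) (Fin 1) ℂ) 0 0) = _
    rw [Matrix.scalar_apply, Matrix.diagonal_apply_eq, map_intCast, map_intCast]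

end RepDet

/-! ### The representation group of a group of exponent two -/

section Generation

variable {G : Type}

theorem RepGroup.cls_eq_zero_of_dim [Group G] (X : MatRep G) (hX : X.dim = 0) :
    RepGroup.cls X = 0 := by
  have : IsEmpty (Fin X.dim) := by rw [hX]; infer_instance
  have h : X.IsShortExact X X :=
    ⟨0, 0, Function.injective_of_subsingleton _, fun _ => ⟨fun _ => ⟨0, Subsingleton.elim _ _⟩,
      fun _ => Subsingleton.elim _ _⟩, fun _ => ⟨0, Subsingleton.elim _ _⟩,
      fun _ _ => Subsingleton.elim _ _, fun _ _ => Subsingleton.elim _ _⟩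
  exact left_eq_add.mp (RepGroup.cls_of_exact h)

/-- A representation with a common eigenvector is an extension of a representation of smaller
dimension by a character. -/
theorem MatRep.exists_quotient_of_eigenvector [Group G] (X : MatRep G) {d : ℕ}
    (hd : X.dim = d + 1) (χ : G →* ℂˣ) (v : Fin X.dim → ℂ) (hv : v ≠ 0)
    (h : ∀ g, (X.ρ g).mulVec v = (χ g : ℂ) • v) :
    ∃ Z : MatRep G, Z.dim = d ∧ RepGroup.cls X = RepGroup.ofChar χ + RepGroup.cls Z := by
  have hrank : Module.finrank ℂ ((Fin X.dim → ℂ) ⧸ (ℂ ∙ v)) = d := by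
    have h1 := (ℂ ∙ v).finrank_quotient_add_finrank
    rw [finrank_span_singleton hv, Module.finrank_fin_fun] at h1
    omega
  let b := Module.finBasisOfFinrankEq ℂ _ hrank
  have hinv : ∀ g, (ℂ ∙ v) ≤ (ℂ ∙ v).comap (Matrix.toLin' (X.ρ g)) := by
    intro g
    rw [Submodule.span_singleton_le_iff_mem, Submodule.mem_comap, Matrix.toLin'_apply, h]
    exact Submodule.smul_mem _ _ (Submodule.mem_span_singleton_self v)
  let Z : MatRep G :=
    { dim := d
      ρ :=
        { toFun := fun g => LinearMap.toMatrix b b ((ℂ ∙ v).mapQ (ℂ ∙ v) _ (hinv g))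
          map_one' := by
            rw [← LinearMap.toMatrix_id b]
            congr 1
            ext
            simp
          map_mul' := fun g g' => by
            rw [← LinearMap.toMatrix_comp]
            congr 1
            ext
            simp [Matrix.toLin'_mul] } }
  refine ⟨Z, rfl, ?_⟩
  refine RepGroup.cls_of_exact ⟨(LinearMap.toSpanSingleton ℂ _ v) ∘ₗ LinearMap.proj 0,
    b.equivFun.toLinearMap ∘ₗ (ℂ ∙ v).mkQ, ?_, ?_, ?_, ?_, ?_⟩
  · intro x y hxy
    have := smul_left_injective ℂ hv hxy
    ext i
    rw [Subsingleton.elim i 0]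
    exact this
  · intro y
    simp only [LinearMap.comp_apply, LinearEquiv.coe_coe, map_eq_zero_iff _ b.equivFun.injective,
      Submodule.mkQ_apply, Submodule.Quotient.mk_eq_zero, Submodule.mem_span_singleton]
    constructor
    · rintro ⟨c, rfl⟩
      exact ⟨fun _ => c, rfl⟩
    · rintro ⟨x, rfl⟩
      exact ⟨x 0, rfl⟩
  · exact b.equivFun.surjective.comp (ℂ ∙ v).mkQ_surjective
  · intro g w
    have : (Matrix.mulVec (Matrix.scalar (Fin 1) (χ g : ℂ)) w) 0 = χ g * w 0 := by
      simp [Matrix.mulVec, dotProduct]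
    simp only [LinearMap.comp_apply, LinearMap.proj_apply, LinearMap.toSpanSingleton_apply,
      Matrix.mulVec_smul, h]
    rw [smul_smul, mul_comm]
    exact congrArg (· • v) this
  · intro g w
    have := LinearMap.toMatrix_mulVec_repr b b ((ℂ ∙ v).mapQ (ℂ ∙ v) _ (hinv g)) ((ℂ ∙ v).mkQ w)
    exact this.symm

variable [CommGroup G] [Finite G] (hG : ∀ g : G, g ^ 2 = 1)
include hG

/-- The indicator function of `χ` corresponds to the idempotent on which $G$ acts through `χ`. -/
theorem single_mul_signIdempotent [DecidableEq (G →* ℤˣ)] (g : G) (χ : G →* ℤˣ) :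
    MonoidAlgebra.single g 1 * (signEquiv G ℚ_[2] hG).symm (Pi.single χ 1) =
      MonoidAlgebra.single 1 ((χ g : ℤ) : ℚ_[2]) *
        (signEquiv G ℚ_[2] hG).symm (Pi.single χ 1) := by
  apply (signEquiv G ℚ_[2] hG).injective
  rw [map_mul, map_mul, AlgEquiv.apply_symm_apply]
  funext ψ
  by_cases h : ψ = χ
  · subst h
    simp [signEquiv_apply, evalSign_single]
  · simp [h]

/-- The idempotents of the characters sum to 1, so one of them does not kill a given nonzero vector
`w`; its image of `w` is the eigenvector. -/
theorem MatRep.exists_eigenvector (X : MatRep G) (hX : 0 < X.dim) :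
    ∃ (χ : G →* ℤˣ) (v : Fin X.dim → ℂ), v ≠ 0 ∧
      ∀ g, (X.ρ g).mulVec v = (complexChar χ g : ℂ) • v := by
  classical
  have := Fintype.ofFinite (G →* ℤˣ)
  -- Any identification will do: it only serves to let the idempotents of $\mathbf Q_2[G]$ act on a
  -- complex vector space.
  let ι : ℂ ≃+* AlgebraicClosure ℚ_[2] := nonempty_ringEquiv.some
  let E : (G →* ℤˣ) → MonoidAlgebra ℚ_[2] G := fun χ =>
    (signEquiv G ℚ_[2] hG).symm (Pi.single χ 1)
  have hE : ∑ χ, E χ = 1 := by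
    rw [← map_sum, Finset.univ_sum_single (fun _ : G →* ℤˣ => (1 : ℚ_[2]))]
    exact map_one _
  let w : Fin X.dim → ℂ := Pi.single ⟨0, hX⟩ 1
  have hw : w ≠ 0 := by simp [w]
  have hsum : ∑ χ, (evalComplex ι X (E χ)).mulVec w = w := by
    rw [← Matrix.sum_mulVec, ← map_sum, hE, map_one, Matrix.one_mulVec]
  obtain ⟨χ, -, hχ⟩ := Finset.exists_ne_zero_of_sum_ne_zero (hsum.trans_ne hw)
  refine ⟨χ, _, hχ, fun g => ?_⟩
  have h1 : X.ρ g = evalComplex ι X (MonoidAlgebra.single g 1) := by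
    rw [evalComplex_single]
    simp
  rw [h1, Matrix.mulVec_mulVec, ← map_mul, single_mul_signIdempotent hG, map_mul,
    evalComplex_single, map_one, ← Matrix.mulVec_mulVec, Matrix.smul_mulVec, Matrix.one_mulVec]
  congr 1
  simp [complexChar]

/-- The representation group of a group of exponent two is generated by its characters. -/
theorem RepGroup.closure_ofChar :
    AddSubgroup.closure (Set.range fun χ : G →* ℤˣ => RepGroup.ofChar (complexChar χ)) = ⊤ := by
  have key : ∀ (d : ℕ) (X : MatRep G), X.dim = d → RepGroup.cls X ∈
      AddSubgroup.closure (Set.range fun χ : G →* ℤˣ => RepGroup.ofChar (complexChar χ)) := by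
    intro d
    induction d with
    | zero =>
      intro X hX
      rw [RepGroup.cls_eq_zero_of_dim X hX]
      exact zero_mem _
    | succ d ih =>
      intro X hX
      obtain ⟨χ, v, hv, h⟩ := X.exists_eigenvector hG (by omega)
      obtain ⟨Z, hZ, hXZ⟩ := X.exists_quotient_of_eigenvector hX (complexChar χ) v hv h
      rw [hXZ]
      exact add_mem (AddSubgroup.subset_closure ⟨χ, rfl⟩) (ih Z hZ)
  rw [eq_top_iff]
  rintro z -
  obtain ⟨w, rfl⟩ := QuotientAddGroup.mk'_surjective _ z
  change RepGroup.mk G w ∈ _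
  induction w using FreeAbelianGroup.induction_on with
  | zero => exact zero_mem _
  | neg T h => rw [map_neg]; exact neg_mem h
  | add x y hx hy => rw [map_add]; exact add_mem hx hy
  | of T => exact key _ T rfl

theorem RepGroup.hom_ext {A : Type*} [AddCommGroup A] {f f' : RepGroup G →+ A}
    (h : ∀ χ : G →* ℤˣ, f (RepGroup.ofChar (complexChar χ)) =
      f' (RepGroup.ofChar (complexChar χ))) : f = f' := by
  refine AddMonoidHom.eq_of_eqOn_dense (RepGroup.closure_ofChar hG) ?_
  rintro _ ⟨χ, rfl⟩
  exact h χ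

end Generation

/-- A surjective homomorphism identifies its codomain with the quotient by its kernel. -/
theorem exists_addEquiv_quotient {A B : Type*} [AddCommGroup A] [AddCommGroup B] (c : A →+ B)
    (hc : Function.Surjective c) (N : AddSubgroup A) (hN : c.ker = N) :
    ∃ e : B ≃+ A ⧸ N, ∀ a : A, e.symm (QuotientAddGroup.mk a) = c a := by
  subst hN
  exact ⟨(QuotientAddGroup.quotientKerEquivOfSurjective c hc).symm, fun _ => rfl⟩

/-! ### Determinantal functions -/

section Determinantal

variable (ι : ℂ ≃+* AlgebraicClosure ℚ_[2]) {G : Type} [CommGroup G] [Finite G]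
  (hG : ∀ g : G, g ^ 2 = 1)

/-- The inclusion of `ℚ₂ˣ` into the units of the algebraic closure. -/
def unitsClosure : Additive ℚ_[2]ˣ →+ Additive (AlgebraicClosure ℚ_[2])ˣ :=
  MonoidHom.toAdditive (Units.map (algebraMap ℚ_[2] (AlgebraicClosure ℚ_[2])).toMonoidHom)

theorem unitsClosure_injective : Function.Injective unitsClosure :=
  Units.map_injective (algebraMap ℚ_[2] (AlgebraicClosure ℚ_[2])).injective

include hG in
-- On characters the values lie in $\mathbf Q_2^*$ by `detRep_ofChar`, and characters generate
-- $R(G)$.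
theorem detRep_mem_range (u : (MonoidAlgebra ℚ_[2] G)ˣ) (r : RepGroup G) :
    detRep ι u r ∈ unitsClosure.range := by
  have hr : r ∈ AddSubgroup.closure (Set.range fun χ : G →* ℤˣ =>
      RepGroup.ofChar (complexChar χ)) := by
    rw [RepGroup.closure_ofChar hG]
    trivial
  induction hr using AddSubgroup.closure_induction with
  | zero => rw [map_zero]; exact zero_mem _
  | add x y _ _ hx hy => rw [map_add]; exact add_mem hx hy
  | neg x _ hx => rw [map_neg]; exact neg_mem hx
  | mem x hx =>
    obtain ⟨χ, rfl⟩ := hx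
    refine ⟨Additive.ofMul (Units.map (evalSign ℚ_[2] χ).toRingHom.toMonoidHom u), ?_⟩
    apply Additive.toMul.injective
    apply Units.ext
    exact (detRep_ofChar ι u χ).symm

/-- The determinant of a unit of `ℚ₂[G]` as an element of `Hom(R(G), ℚ₂ˣ)`. -/
def detQ (u : (MonoidAlgebra ℚ_[2] G)ˣ) : HomQ G :=
  (AddMonoidHom.ofInjective unitsClosure_injective).symm.toAddMonoidHom.comp
    ((detRep ι u).codRestrict unitsClosure.range (detRep_mem_range ι hG u))

theorem unitsClosure_detQ (u : (MonoidAlgebra ℚ_[2] G)ˣ) (r : RepGroup G) :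
    unitsClosure (detQ ι hG u r) = detRep ι u r := by
  have := AddMonoidHom.apply_ofInjective_symm unitsClosure_injective
    ⟨detRep ι u r, detRep_mem_range ι hG u r⟩
  exact this

theorem detQ_ofChar (u : (MonoidAlgebra ℚ_[2] G)ˣ) (χ : G →* ℤˣ) :
    (detQ ι hG u).val (RepGroup.ofChar (complexChar χ)) = evalSign ℚ_[2] χ u := by
  apply (algebraMap ℚ_[2] (AlgebraicClosure ℚ_[2])).injective
  rw [← detRep_ofChar ι, ← unitsClosure_detQ ι hG]
  rfl

include hG in
theorem HomQ.ext_of_ofChar {f f' : HomQ G} (h : ∀ χ : G →* ℤˣ,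
    f.val (RepGroup.ofChar (complexChar χ)) = f'.val (RepGroup.ofChar (complexChar χ))) :
    f = f' :=
  RepGroup.hom_ext hG fun χ => Additive.toMul.injective (Units.ext (h χ))

theorem isDet_iff {n : ℕ} (Φ : Matrix (Fin n) (Fin n) (MonoidAlgebra ℚ_[2] G))
    (u : (MonoidAlgebra ℚ_[2] G)ˣ) (hu : Φ.det = u) (f : HomQ G) :
    IsDet ι Φ f ↔ f = detQ ι hG u := by
  have h : IsDet ι Φ (detQ ι hG u) := by
    intro X
    rw [detAt_eq, hu, ← detRep_cls, ← unitsClosure_detQ ι hG]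
    rfl
  constructor
  · intro hf
    refine RepGroup.hom_ext hG fun χ => Additive.toMul.injective (Units.ext ?_)
    apply (algebraMap ℚ_[2] (AlgebraicClosure ℚ_[2])).injective
    exact (hf _).trans (h _).symm
  · rintro rfl
    exact h

/-- `ℚ₂[G]ˣ ≅ Hom(R(G), ℚ₂ˣ)` for a group `G` of exponent two. -/
def detQEquiv : Additive (MonoidAlgebra ℚ_[2] G)ˣ ≃+ HomQ G :=
  AddEquiv.ofBijective
    ({ toFun := fun u => detQ ι hG u.toMul
       map_zero' := HomQ.ext_of_ofChar hG fun χ => by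
          rw [detQ_ofChar]
          simp [HomQ.val]
       map_add' := fun u v => HomQ.ext_of_ofChar hG fun χ => by
          rw [detQ_ofChar, toMul_add, Units.val_mul, map_mul, ← detQ_ofChar ι hG,
            ← detQ_ofChar ι hG]
          simp [HomQ.val] } : Additive (MonoidAlgebra ℚ_[2] G)ˣ →+ HomQ G) <| by
    constructor
    · intro u v huv
      apply Additive.toMul.injective
      apply Units.ext
      apply (signEquiv G ℚ_[2] hG).injective
      funext χ
      rw [signEquiv_apply, signEquiv_apply, ← detQ_ofChar ι hG, ← detQ_ofChar ι hG]
      exact congrArg (fun f : HomQ G => f.val _) huv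
    · intro f
      let a : ((G →* ℤˣ) → ℚ_[2])ˣ := MulEquiv.piUnits.symm fun χ =>
        (f (RepGroup.ofChar (complexChar χ))).toMul
      refine ⟨Additive.ofMul (Units.map (signEquiv G ℚ_[2] hG).symm.toRingEquiv.toMonoidHom a),
        HomQ.ext_of_ofChar hG fun χ => ?_⟩
      refine (detQ_ofChar ι hG _ χ).trans ?_
      rw [← signEquiv_apply ℚ_[2] hG]
      exact congrFun ((signEquiv G ℚ_[2] hG).apply_symm_apply a.1) χ

theorem detQEquiv_ofChar (u : Additive (MonoidAlgebra ℚ_[2] G)ˣ) (χ : G →* ℤˣ) :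
    (detQEquiv ι hG u).val (RepGroup.ofChar (complexChar χ)) = evalSign ℚ_[2] χ u.toMul :=
  detQ_ofChar ι hG u.toMul χ

/-- Under `detQEquiv` the group $\mathrm{Det}(\mathbf Z_2[G]^*)$ becomes the image of $\mathbf
Z_2[G]^*$, which is the kernel of `K0Rel.ofUnit`. -/
theorem mem_detUnits_iff (f : HomQ G) :
    f ∈ detUnits ι G ↔ ((detQEquiv ι hG).symm f).toMul ∈
      unitsRange (MonoidAlgebra ℤ_[2] G) (MonoidAlgebra ℚ_[2] G) := by
  have h : ∀ v : (MonoidAlgebra ℤ_[2] G)ˣ, IsDet ι (unitMatrix v) f ↔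
      (detQEquiv ι hG).symm f = Additive.ofMul (Units.map (algebraMap (MonoidAlgebra ℤ_[2] G)
        (MonoidAlgebra ℚ_[2] G)).toMonoidHom v) := by
    intro v
    rw [isDet_iff ι hG _ (Units.map (algebraMap (MonoidAlgebra ℤ_[2] G)
        (MonoidAlgebra ℚ_[2] G)).toMonoidHom v) (by simp [unitMatrix]), AddEquiv.symm_apply_eq]
    rfl
  constructor
  · rintro ⟨v, hv⟩
    exact ⟨v, congrArg Additive.toMul ((h v).mp hv).symm⟩
  · rintro ⟨v, hv⟩
    exact ⟨v, (h v).mpr (congrArg Additive.ofMul hv).symm⟩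

/-- The element of `K₀(ℤ₂[G]; ℚ₂)` with a given Hom-description. -/
def ofHomQ : HomQ G →+ K0ZQ G :=
  (K0Rel.ofUnit _ _).comp (detQEquiv ι hG).symm.toAddMonoidHom

variable [IsLocalRing (MonoidAlgebra ℤ_[2] G)]

theorem ofHomQ_surjective : Function.Surjective (ofHomQ ι hG) :=
  (K0Rel.ofUnit_surjective (signEquiv G ℚ_[2] hG).toRingEquiv two_ne_zero).comp
    (detQEquiv ι hG).symm.surjective

theorem ker_ofHomQ : (ofHomQ ι hG).ker = detUnits ι G := by
  ext f
  rw [mem_detUnits_iff ι hG, ← K0Rel.ofUnit_eq_zero_iff]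
  rfl

/-- The Hom-description for a group of exponent two. -/
theorem exists_homDescription (N : AddSubgroup (HomQ G)) (hN : detUnits ι G = N) :
    ∃ h : K0ZQ G ≃+ HomQ G ⧸ N, IsHomDescription ι N h ∧
      ∀ z f, h z = QuotientAddGroup.mk f → z = ofHomQ ι hG f := by
  obtain ⟨h, hh⟩ := exists_addEquiv_quotient (ofHomQ ι hG) (ofHomQ_surjective ι hG) N
    ((ker_ofHomQ ι hG).trans hN)
  refine ⟨h, ?_, fun z f hz => ?_⟩
  · intro n T x y Φ hΦ
    -- The coefficients of $φ(x_i)$ form the rows of `Φ` but the columns of `LinearMap.toMatrix`,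
    -- hence the transpose.
    have hdet : Φ.det = relDet T.φ x y := by
      rw [coe_relDet, ← Matrix.det_transpose]
      congr 1
      refine Matrix.ext fun i j => ?_
      rw [LinearMap.toMatrix_apply, Algebra.TensorProduct.basis_apply]
      change Φ j i = (Module.Basis.repr _) (T.φ (1 ⊗ₜ x j)) i
      rw [hΦ, map_sum, Finsupp.finsetSum_apply, Finset.sum_eq_single i]
      · rw [map_smul, ← Algebra.TensorProduct.basis_apply, Module.Basis.repr_self]
        simp
      · intro k _ hk
        rw [map_smul, ← Algebra.TensorProduct.basis_apply, Module.Basis.repr_self]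
        simp [hk]
      · simp
    refine ⟨detQ ι hG (relDet T.φ x y), (isDet_iff ι hG Φ _ hdet _).mpr rfl, ?_⟩
    rw [← AddEquiv.eq_symm_apply, hh]
    rw [K0Rel.cls_eq_ofUnit (signEquiv G ℚ_[2] hG).toRingEquiv two_ne_zero T x y]
    have : detQ ι hG (relDet T.φ x y) = detQEquiv ι hG (Additive.ofMul (relDet T.φ x y)) := rfl
    rw [this]
    simp [ofHomQ]
  · rw [← hh, ← hz, AddEquiv.symm_apply_apply]

end Determinantal

/-! ### Integral group rings of groups of exponent two -/

section Integral

variable {G : Type} [CommGroup G]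

theorem evalSign_one_surjective (k : Type) [CommRing k] :
    Function.Surjective (evalSign k (1 : G →* ℤˣ)) := fun r =>
  ⟨MonoidAlgebra.single 1 r, by simp [evalSign_single]⟩

variable [Finite G]

/-- `ℤ₂[G]` is local for a group `G` of exponent two. -/
theorem isLocalRing_intGroupRing (hG : ∀ g : G, g ^ 2 = 1) :
    IsLocalRing (MonoidAlgebra ℤ_[2] G) := by
  let aug : MonoidAlgebra ℤ_[2] G →+* ZMod 2 :=
    (PadicInt.toZMod (p := 2)).comp (evalSign ℤ_[2] (1 : G →* ℤˣ)).toRingHom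
  have haug : Function.Surjective aug :=
    (ZMod.ringHom_surjective (PadicInt.toZMod (p := 2))).comp (evalSign_one_surjective _)
  have hmax : (RingHom.ker aug).IsMaximal := RingHom.ker_isMaximal_of_surjective aug haug
  refine IsLocalRing.of_unique_max_ideal ⟨RingHom.ker aug, hmax, fun m hm => ?_⟩
  refine (hmax.eq_of_le hm.ne_top fun x hx => ?_).symm
  -- $\mathbf Z_2[G]$ is integral over $\mathbf Z_2$, so `m` contracts to the maximal ideal $(2)$.
  have h2 : algebraMap ℤ_[2] (MonoidAlgebra ℤ_[2] G) 2 ∈ m := by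
    have h1 := Ideal.isMaximal_comap_of_isIntegral_of_isMaximal (R := ℤ_[2]) m
    have h3 : (2 : ℤ_[2]) ∈ IsLocalRing.maximalIdeal ℤ_[2] := by
      rw [PadicInt.maximalIdeal_eq_span_p]
      exact Ideal.mem_span_singleton_self _
    rw [← IsLocalRing.eq_maximalIdeal h1] at h3
    exact h3
  have h2' : (2 : MonoidAlgebra ℤ_[2] G ⧸ m) = 0 := by
    rw [map_ofNat] at h2
    exact (map_ofNat (Ideal.Quotient.mk m) 2).symm.trans (Ideal.Quotient.eq_zero_iff_mem.mpr h2)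
  have := Ideal.Quotient.field m
  -- The residue field has characteristic two and $g^2 = 1$, so $(g - 1)^2 = 0$ and every `g` maps
  -- to 1. The quotient map therefore factors through the augmentation.
  have hg : ∀ g : G, Ideal.Quotient.mk m (MonoidAlgebra.single g 1) = 1 := by
    intro g
    have hsq : Ideal.Quotient.mk m (MonoidAlgebra.single g 1) ^ 2 = 1 := by
      rw [← map_pow, MonoidAlgebra.single_pow, hG, one_pow, ← MonoidAlgebra.one_def, map_one]
    have : (Ideal.Quotient.mk m (MonoidAlgebra.single g 1) - 1) ^ 2 = 0 := by
      linear_combination hsq + (1 - Ideal.Quotient.mk m (MonoidAlgebra.single g 1)) * h2'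
    exact sub_eq_zero.mp (pow_eq_zero_iff two_ne_zero |>.mp this)
  have hfac : Ideal.Quotient.mk m = ((Ideal.Quotient.mk m).comp
      (algebraMap ℤ_[2] (MonoidAlgebra ℤ_[2] G))).comp
      (evalSign ℤ_[2] (1 : G →* ℤˣ)).toRingHom := by
    apply MonoidAlgebra.ringHom_ext
    · intro r
      have h1 : evalSign ℤ_[2] (1 : G →* ℤˣ) (MonoidAlgebra.single 1 r) = r := by
        simp [evalSign_single]
      change _ = Ideal.Quotient.mk m (algebraMap _ _ (evalSign ℤ_[2] (1 : G →* ℤˣ) _))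
      rw [h1]
      rfl
    · intro g
      rw [hg]
      simp [evalSign_single]
  have hx' : evalSign ℤ_[2] (1 : G →* ℤˣ) x ∈ Ideal.span {(2 : ℤ_[2])} := by
    have : evalSign ℤ_[2] (1 : G →* ℤˣ) x ∈ RingHom.ker (PadicInt.toZMod (p := 2)) := hx
    rw [PadicInt.ker_toZMod, PadicInt.maximalIdeal_eq_span_p] at this
    exact_mod_cast this
  obtain ⟨y, hy⟩ := Ideal.mem_span_singleton.mp hx'
  rw [← Ideal.Quotient.eq_zero_iff_mem, hfac]
  change Ideal.Quotient.mk m (algebraMap _ _ (evalSign ℤ_[2] (1 : G →* ℤˣ) x)) = 0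
  rw [hy, map_mul, map_mul, Ideal.Quotient.eq_zero_iff_mem.mpr h2, zero_mul]

/-- Elements of `ℤ₂[G]` with prescribed values at the characters. -/
theorem exists_evalSign_eq [Fintype (G →* ℤˣ)] (a : (G →* ℤˣ) → ℤ_[2])
    (ha : ∀ g : G, (Nat.card G : ℤ_[2]) ∣ ∑ χ : G →* ℤˣ, ((χ g : ℤ) : ℤ_[2]) * a χ) :
    ∃ v : MonoidAlgebra ℤ_[2] G, ∀ χ, evalSign ℤ_[2] χ v = a χ := by
  classical
  have := Fintype.ofFinite G
  -- Fourier inversion: the coefficient at `g` must be $|G|^{-1} \sum_\chi \chi(g) a_\chi$, integral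
  -- by hypothesis.
  choose c hc using ha
  refine ⟨∑ g, MonoidAlgebra.single g (c g), fun ψ => ?_⟩
  have hne : (Nat.card G : ℤ_[2]) ≠ 0 := Nat.cast_ne_zero.mpr Nat.card_pos.ne'
  apply mul_left_cancel₀ hne
  simp only [map_sum, evalSign_single, Finset.mul_sum]
  calc ∑ g, (Nat.card G : ℤ_[2]) * (c g * ((ψ g : ℤ) : ℤ_[2]))
      = ∑ g, ∑ χ : G →* ℤˣ, a χ * (((χ g : ℤ) : ℤ_[2]) * ((ψ g : ℤ) : ℤ_[2])) := by
        refine Finset.sum_congr rfl fun g _ => ?_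
        rw [← mul_assoc, ← hc, Finset.sum_mul]
        exact Finset.sum_congr rfl fun χ _ => by ring
    _ = (Nat.card G : ℤ_[2]) * a ψ := by
        rw [Finset.sum_comm]
        simp only [← Finset.mul_sum, sum_signChar_mul ℤ_[2]]
        simp [mul_comm, Nat.card_eq_fintype_card]

variable (ι : ℂ ≃+* AlgebraicClosure ℚ_[2]) (hG : ∀ g : G, g ^ 2 = 1)

include hG in
theorem mem_detUnits_iff_exists_unit (f : HomQ G) :
    f ∈ detUnits ι G ↔ ∃ v : (MonoidAlgebra ℤ_[2] G)ˣ, ∀ χ : G →* ℤˣ,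
      f.val (RepGroup.ofChar (complexChar χ)) = (evalSign ℤ_[2] χ v : ℤ_[2]) := by
  rw [mem_detUnits_iff ι hG]
  refine exists_congr fun v => ?_
  have hv : ∀ χ : G →* ℤˣ, evalSign ℚ_[2] χ (algebraMap (MonoidAlgebra ℤ_[2] G)
      (MonoidAlgebra ℚ_[2] G) v) = (evalSign ℤ_[2] χ v : ℤ_[2]) := fun χ =>
    evalSign_mapRingHom (algebraMap ℤ_[2] ℚ_[2]) χ v
  constructor
  · intro h χ
    rw [← hv]
    refine Eq.trans ?_ (congrArg (fun u : (MonoidAlgebra ℚ_[2] G)ˣ =>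
      evalSign ℚ_[2] χ (u : MonoidAlgebra ℚ_[2] G)) h.symm)
    rw [← detQEquiv_ofChar ι hG, AddEquiv.apply_symm_apply]
  · intro h
    apply Additive.ofMul.injective
    refine Eq.trans ?_ (ofMul_toMul _).symm
    rw [AddEquiv.eq_symm_apply]
    refine HomQ.ext_of_ofChar hG fun χ => ?_
    rw [detQEquiv_ofChar, h, ← hv]
    rfl

include hG in
-- Since $\mathbf Z_2[G]$ is local, the surjective augmentation is a local homomorphism, so
-- invertibility at the trivial character makes `v` a unit.
theorem mem_detUnits_of_integral (f : HomQ G) (v : MonoidAlgebra ℤ_[2] G)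
    (hv : ∀ χ : G →* ℤˣ, f.val (RepGroup.ofChar (complexChar χ)) = (evalSign ℤ_[2] χ v : ℤ_[2]))
    (h1 : IsUnit (evalSign ℤ_[2] 1 v)) : f ∈ detUnits ι G := by
  have := isLocalRing_intGroupRing hG
  have := IsLocalHom.of_surjective (evalSign ℤ_[2] (1 : G →* ℤˣ)).toRingHom
    (evalSign_one_surjective _)
  obtain ⟨u, rfl⟩ := isUnit_of_map_unit (evalSign ℤ_[2] (1 : G →* ℤˣ)).toRingHom v h1
  exact (mem_detUnits_iff_exists_unit ι hG f).mpr ⟨u, hv⟩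

include hG in
/-- There is an element of `Hom(R(G), ℚ₂ˣ)` with prescribed values at the characters. -/
theorem exists_homQ_ofChar (a : (G →* ℤˣ) → ℚ_[2]ˣ) :
    ∃ f : HomQ G, ∀ χ, f (RepGroup.ofChar (complexChar χ)) = Additive.ofMul (a χ) := by
  let u : (MonoidAlgebra ℚ_[2] G)ˣ := Units.map
    (signEquiv G ℚ_[2] hG).symm.toRingEquiv.toMonoidHom (MulEquiv.piUnits.symm a)
  refine ⟨detQEquiv nonempty_ringEquiv.some hG (Additive.ofMul u), fun χ =>
    Additive.toMul.injective (Units.ext ?_)⟩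
  refine (detQEquiv_ofChar _ hG _ χ).trans ?_
  exact congrFun ((signEquiv G ℚ_[2] hG).apply_symm_apply (MulEquiv.piUnits.symm a).1) χ

end Integral

/-! ### Valuations and unit parts -/

section Valuation

/-- The valuation on `ℚ₂ˣ`. -/
def valuationHom : Additive ℚ_[2]ˣ →+ ℤ where
  toFun z := (z.toMul : ℚ_[2]).valuation
  map_zero' := Padic.valuation_one
  map_add' z w := Padic.valuation_mul z.toMul.ne_zero w.toMul.ne_zero

theorem coe_unitPart (z : ℚ_[2]ˣ) : ((unitPart z : ℤ_[2]) : ℚ_[2]) =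
    (z : ℚ_[2]) * (2 : ℚ_[2]) ^ (-(z : ℚ_[2]).valuation) :=
  PadicInt.mkUnits_eq _

/-- The unit part as a homomorphism. -/
def unitPartHom : ℚ_[2]ˣ →* ℤ_[2]ˣ where
  toFun := unitPart
  map_one' := by
    apply Units.ext
    apply Subtype.ext
    rw [coe_unitPart]
    simp
  map_mul' z w := by
    apply Units.ext
    apply Subtype.ext
    rw [coe_unitPart, Units.val_mul, Units.val_mul,
      Padic.valuation_mul z.ne_zero w.ne_zero, neg_add, zpow_add₀ two_ne_zero]
    change _ = ((unitPart z : ℤ_[2]) : ℚ_[2]) * ((unitPart w : ℤ_[2]) : ℚ_[2])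
    rw [coe_unitPart, coe_unitPart]
    ring

theorem norm_eq_one_iff_valuation (z : ℚ_[2]ˣ) :
    ‖(z : ℚ_[2])‖ = 1 ↔ (z : ℚ_[2]).valuation = 0 := by
  rw [Padic.norm_eq_zpow_neg_valuation z.ne_zero]
  constructor
  · intro h
    have := (zpow_eq_one_iff_right₀ (by positivity) (by norm_num)).mp h
    omega
  · intro h
    simp [h]

theorem coe_unitPart_of_valuation {z : ℚ_[2]ˣ} (hz : (z : ℚ_[2]).valuation = 0) :
    ((unitPart z : ℤ_[2]) : ℚ_[2]) = z := by
  rw [coe_unitPart, hz]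
  simp

end Valuation

/-! ### Functions with values in $\mathbf Z_2^*$ for groups of order at most two -/

section HomZ

variable {G : Type} [CommGroup G] [Finite G] (ι : ℂ ≃+* AlgebraicClosure ℚ_[2])
  (hG : ∀ g : G, g ^ 2 = 1)

include hG in
theorem mem_homZ_iff (f : HomQ G) : f ∈ homZ G ↔
    ∀ χ : G →* ℤˣ, ‖f.val (RepGroup.ofChar (complexChar χ))‖ = 1 := by
  refine ⟨fun h χ => h _, fun h r => ?_⟩
  have hr : r ∈ AddSubgroup.closure (Set.range fun χ : G →* ℤˣ =>
      RepGroup.ofChar (complexChar χ)) := by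
    rw [RepGroup.closure_ofChar hG]
    trivial
  simp only [HomQ.val] at h ⊢
  induction hr using AddSubgroup.closure_induction with
  | zero => simp
  | add x y _ _ hx hy => simp [hx, hy]
  | neg x _ hx => simp [hx]
  | mem x hx =>
    obtain ⟨χ, rfl⟩ := hx
    exact h χ

theorem toZMod_unit (a : ℤ_[2]ˣ) : PadicInt.toZMod (a : ℤ_[2]) = (1 : ZMod 2) := by
  have h : ∀ b : (ZMod 2)ˣ, (b : ZMod 2) = 1 := by decide
  exact h (Units.map (PadicInt.toZMod (p := 2)).toMonoidHom a)

include hG in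
/-- For a group of order at most two, all functions with values in `ℤ₂ˣ` are determinants of units
of `ℤ₂[G]`. -/
theorem detUnits_eq_homZ (hcard : Nat.card G = 1 ∨ Nat.card G = 2) : detUnits ι G = homZ G := by
  ext f
  rw [mem_homZ_iff hG]
  constructor
  · rw [mem_detUnits_iff_exists_unit ι hG]
    rintro ⟨v, hv⟩ χ
    rw [hv]
    exact PadicInt.isUnit_iff.mp (v.isUnit.map (evalSign ℤ_[2] χ))
  · intro h
    have := Fintype.ofFinite (G →* ℤˣ)
    let a : (G →* ℤˣ) → ℤ_[2]ˣ := fun χ => unitPart (f (RepGroup.ofChar (complexChar χ))).toMul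
    have ha : ∀ χ, ((a χ : ℤ_[2]) : ℚ_[2]) = f.val (RepGroup.ofChar (complexChar χ)) := fun χ =>
      coe_unitPart_of_valuation ((norm_eq_one_iff_valuation _).mp (h χ))
    -- Nothing is to be checked for order 1; for order 2 a sum of two units of $\mathbf Z_2$ is
    -- even.
    obtain ⟨v, hv⟩ := exists_evalSign_eq (fun χ => (a χ : ℤ_[2])) fun g => by
      rcases hcard with hc | hc
      · rw [hc]
        simp
      · rw [hc, Nat.cast_two]
        have : ∑ χ : G →* ℤˣ, ((χ g : ℤ) : ℤ_[2]) * a χ ∈ RingHom.ker (PadicInt.toZMod (p := 2)) := by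
          have hunit : ∀ χ : G →* ℤˣ, ((χ g : ℤ) : ℤ_[2]) * a χ =
            ((Units.map (Int.castRingHom ℤ_[2]).toMonoidHom (χ g) * a χ : ℤ_[2]ˣ) : ℤ_[2]) :=
              fun χ => rfl
          rw [RingHom.mem_ker, map_sum]
          simp only [hunit, toZMod_unit]
          rw [Finset.sum_const, Finset.card_univ, ← Nat.card_eq_fintype_card, card_signChar hG, hc]
          rfl
        rw [PadicInt.ker_toZMod, PadicInt.maximalIdeal_eq_span_p, Ideal.mem_span_singleton] at this
        exact_mod_cast this
    refine mem_detUnits_of_integral ι hG f v (fun χ => ?_) ?_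
    · rw [hv, ha]
    · rw [hv]
      exact (a 1).isUnit

end HomZ

/-! ### Induction -/

section Induction

theorem rid_comp_baseChangeIso_smulOfUnit (R S R' S' : Type) [CommRing R] [CommRing S] [CommRing R']
    [CommRing S'] [Algebra R S] [Algebra R R'] [Algebra S S'] [Algebra R' S'] [Algebra R S']
    [IsScalarTower R R' S'] [IsScalarTower R S S'] (a : Sˣ) :
    (LinearEquiv.smulOfUnit (M := S' ⊗[R'] R')
        (Units.map (algebraMap S S').toMonoidHom a)).toLinearMap ∘ₗ
        (TensorProduct.AlgebraTensorModule.rid R R' R').toLinearMap.baseChange S' =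
      (TensorProduct.AlgebraTensorModule.rid R R' R').toLinearMap.baseChange S' ∘ₗ
        (baseChangeIso R S R' S' (LinearEquiv.smulOfUnit (M := S ⊗[R] R) a)).toLinearMap := by
  apply TensorProduct.AlgebraTensorModule.curry_injective
  ext
  simp [baseChangeIso, LinearEquiv.smulOfUnit, Units.smul_def, TensorProduct.smul_tmul',
    Algebra.smul_def]

/-- The identification $R' \otimes_R R \cong R'$ is an isomorphism of triples. -/
theorem K0Rel.baseChange_ofUnit (R S R' S' : Type) [CommRing R] [CommRing S] [CommRing R']
    [CommRing S'] [Algebra R S] [Algebra R R'] [Algebra S S'] [Algebra R' S'] [Algebra R S']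
    [IsScalarTower R R' S'] [IsScalarTower R S S'] (a : Sˣ) :
    K0Rel.baseChange R S R' S' (K0Rel.ofUnit R S (Additive.ofMul a)) =
      K0Rel.ofUnit R' S' (Additive.ofMul (Units.map (algebraMap S S').toMonoidHom a)) := by
  refine (K0Rel.baseChange_cls R S R' S' _).trans ?_
  exact K0Rel.cls_congr _ _ (TensorProduct.AlgebraTensorModule.rid R R' R')
    (TensorProduct.AlgebraTensorModule.rid R R' R') (rid_comp_baseChangeIso_smulOfUnit R S R' S' a)

theorem res_ofChar {G : Type} [CommGroup G] (H : Subgroup G) (χ : G →* ℤˣ) :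
    res H (RepGroup.ofChar (complexChar χ)) =
      RepGroup.ofChar (complexChar (χ.comp H.subtype)) :=
  res_cls H _

theorem evalSign_algebraMap {G : Type} [CommGroup G] (H : Subgroup G) (χ : G →* ℤˣ)
    (u : MonoidAlgebra ℚ_[2] H) :
    evalSign ℚ_[2] χ (algebraMap (MonoidAlgebra ℚ_[2] H) (MonoidAlgebra ℚ_[2] G) u) =
      evalSign ℚ_[2] (χ.comp H.subtype) u := by
  rw [RingHom.algebraMap_toAlgebra]
  induction u using MonoidAlgebra.induction_linear with
  | zero => simp
  | add x y hx hy => simp only [map_add, hx, hy]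
  | single g r => simp [evalSign_single]

variable {G : Type} [CommGroup G] [Finite G] (ι : ℂ ≃+* AlgebraicClosure ℚ_[2])
  (hG : ∀ g : G, g ^ 2 = 1)

/-- On Hom-descriptions, induction is composition with restriction. -/
theorem ind_ofHomQ (H : Subgroup G) (hH : ∀ g : H, g ^ 2 = 1) (f : HomQ H) :
    ind G H (ofHomQ ι hH f) = ofHomQ ι hG (f.comp (res H)) := by
  obtain ⟨u, rfl⟩ := (detQEquiv ι hH).surjective f
  have h : (detQEquiv ι hH u).comp (res H) = detQEquiv ι hG (Additive.ofMul
      (Units.map (algebraMap (MonoidAlgebra ℚ_[2] H) (MonoidAlgebra ℚ_[2] G)).toMonoidHom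
        u.toMul)) := by
    refine HomQ.ext_of_ofChar hG fun χ => ?_
    rw [detQEquiv_ofChar]
    refine Eq.trans ?_ (evalSign_algebraMap H χ u.toMul).symm
    rw [← detQEquiv_ofChar ι hH, ← res_ofChar]
    rfl
  have h1 : ofHomQ ι hH (detQEquiv ι hH u) = K0Rel.ofUnit _ _ u := by simp [ofHomQ]
  rw [h, h1]
  refine (K0Rel.baseChange_ofUnit _ _ _ _ u.toMul).trans ?_
  simp [ofHomQ]

end Induction

/-! ### The abelianization of the quaternion group -/

section Quaternion

open QuaternionGroup

/-- Every square in $Q_8$ is 1 or the commutator of $x$ and $y$. -/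
theorem q8ab_sq (g : Q8ab) : g ^ 2 = 1 := by
  obtain ⟨q, rfl⟩ := QuotientGroup.mk_surjective g
  have h : ∀ q : QuaternionGroup 2, q ^ 2 = 1 ∨
      q ^ 2 = a 1 * xa 0 * (a 1)⁻¹ * (xa 0)⁻¹ := by decide
  change Abelianization.of q ^ 2 = 1
  rw [← map_pow]
  rcases h q with h | h
  · rw [h, map_one]
  · rw [h]
    simp only [map_mul, map_inv]
    rw [mul_comm (Abelianization.of (a 1 : QuaternionGroup 2)), mul_inv_cancel_right,
      mul_inv_cancel]

/-- `sign₁` as a character of the abelianization. -/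
def s₁ : Q8ab →* ℤˣ := Abelianization.lift sign₁

/-- `sign₂` as a character of the abelianization. -/
def s₂ : Q8ab →* ℤˣ := Abelianization.lift sign₂

theorem signChar_q8ab_ext {χ ψ : Q8ab →* ℤˣ}
    (h1 : χ (Abelianization.of (a 1)) = ψ (Abelianization.of (a 1)))
    (h2 : χ (Abelianization.of (xa 0)) = ψ (Abelianization.of (xa 0))) : χ = ψ := by
  have ha : ∀ i : ZMod (2 * 2), χ (Abelianization.of (a i)) = ψ (Abelianization.of (a i)) := by
    intro i
    have : (a i : QuaternionGroup 2) = a 1 ^ i.val := by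
      rw [a_one_pow]
      simp
    rw [this, map_pow, map_pow, map_pow, h1]
  apply Abelianization.hom_ext
  ext q
  cases q with
  | a i => exact congrArg _ (ha i)
  | xa i =>
    have : (xa i : QuaternionGroup 2) = xa 0 * a i := by rw [xa_mul_a, zero_add]
    simp only [MonoidHom.comp_apply, this, map_mul, h2, ha]

theorem s₁_a : s₁ (Abelianization.of (a 1)) = -1 := by
  rw [s₁, Abelianization.lift_apply_of]
  decide

theorem s₁_xa : s₁ (Abelianization.of (xa 0)) = 1 := by
  rw [s₁, Abelianization.lift_apply_of]
  decide

theorem s₂_a : s₂ (Abelianization.of (a 1)) = 1 := by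
  rw [s₂, Abelianization.lift_apply_of]
  decide

theorem s₂_xa : s₂ (Abelianization.of (xa 0)) = -1 := by
  rw [s₂, Abelianization.lift_apply_of]
  decide

theorem signChar_q8ab_cases (χ : Q8ab →* ℤˣ) : χ = 1 ∨ χ = s₁ ∨ χ = s₂ ∨ χ = s₁ * s₂ := by
  rcases Int.units_eq_one_or (χ (Abelianization.of (a 1))) with h1 | h1 <;>
    rcases Int.units_eq_one_or (χ (Abelianization.of (xa 0))) with h2 | h2
  · exact Or.inl (signChar_q8ab_ext (by rw [h1]; rfl) (by rw [h2]; rfl))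
  · exact Or.inr (Or.inr (Or.inl (signChar_q8ab_ext (by rw [h1, s₂_a]) (by rw [h2, s₂_xa]))))
  · exact Or.inr (Or.inl (signChar_q8ab_ext (by rw [h1, s₁_a]) (by rw [h2, s₁_xa])))
  · exact Or.inr (Or.inr (Or.inr (signChar_q8ab_ext
      (by rw [h1, MonoidHom.mul_apply, s₁_a, s₂_a]; rfl)
      (by rw [h2, MonoidHom.mul_apply, s₁_xa, s₂_xa]; rfl))))

theorem signChar_ne {χ ψ : Q8ab →* ℤˣ} (h : χ (Abelianization.of (a 1)) ≠
    ψ (Abelianization.of (a 1)) ∨ χ (Abelianization.of (xa 0)) ≠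
    ψ (Abelianization.of (xa 0))) : χ ≠ ψ := by
  rintro rfl
  simp at h

theorem one_ne_s₁ : (1 : Q8ab →* ℤˣ) ≠ s₁ :=
  signChar_ne (Or.inl (by rw [s₁_a, MonoidHom.one_apply]; decide))

theorem one_ne_s₂ : (1 : Q8ab →* ℤˣ) ≠ s₂ :=
  signChar_ne (Or.inr (by rw [s₂_xa, MonoidHom.one_apply]; decide))

theorem s₁_ne_s₂ : s₁ ≠ s₂ :=
  signChar_ne (Or.inl (by rw [s₁_a, s₂_a]; decide))

theorem univ_signChar_q8ab [Fintype (Q8ab →* ℤˣ)] [DecidableEq (Q8ab →* ℤˣ)] :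
    (Finset.univ : Finset (Q8ab →* ℤˣ)) = {1, s₁, s₂, s₁ * s₂} := by
  ext χ
  simpa using signChar_q8ab_cases χ

theorem sum_signChar_q8ab [Fintype (Q8ab →* ℤˣ)] {M : Type*} [AddCommMonoid M]
    (F : (Q8ab →* ℤˣ) → M) : ∑ χ, F χ = F 1 + F s₁ + F s₂ + F (s₁ * s₂) := by
  classical
  have h12 : (1 : Q8ab →* ℤˣ) ≠ s₁ * s₂ :=
    signChar_ne (Or.inl (by rw [MonoidHom.mul_apply, s₁_a, s₂_a, MonoidHom.one_apply]; decide))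
  have h1 : s₁ ≠ s₁ * s₂ := fun h => one_ne_s₂ (left_eq_mul.mp h).symm
  have h2 : s₂ ≠ s₁ * s₂ := fun h => one_ne_s₁ (right_eq_mul.mp h).symm
  rw [univ_signChar_q8ab, Finset.sum_insert (by simp [one_ne_s₁, one_ne_s₂, h12]),
    Finset.sum_insert (by simp [s₁_ne_s₂, one_ne_s₂.symm]), Finset.sum_insert (by simp [one_ne_s₁.symm]),
    Finset.sum_singleton]
  abel

/-- The order is found by counting sign characters. -/
theorem card_q8ab : Nat.card Q8ab = 4 := by
  have := Fintype.ofFinite (Q8ab →* ℤˣ)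
  rw [← card_signChar q8ab_sq, Nat.card_eq_fintype_card, Fintype.card_eq_sum_ones,
    sum_signChar_q8ab]

theorem charSum_eq : charSum = RepGroup.ofChar (complexChar (1 : Q8ab →* ℤˣ)) +
    RepGroup.ofChar (complexChar s₁) + RepGroup.ofChar (complexChar s₂) +
    RepGroup.ofChar (complexChar (s₁ * s₂)) := by
  have h0 : (1 : Q8ab →* ℂˣ) = complexChar 1 := by
    ext
    simp [complexChar]
  have h1 : χ₁ = complexChar s₁ := Abelianization.hom_ext _ _ rfl
  have h2 : χ₂ = complexChar s₂ := Abelianization.hom_ext _ _ rfl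
  have h3 : χ₁ * χ₂ = complexChar (s₁ * s₂) := by
    rw [h1, h2]
    ext
    simp [complexChar]
  rw [charSum, h0, h3, h1, h2]

/-- A subgroup of order at most two is contained in the kernel of a nontrivial character. -/
theorem exists_signChar_trivial (H : Subgroup Q8ab) (hH : Nat.card H = 1 ∨ Nat.card H = 2) :
    s₁.comp H.subtype = 1 ∨ s₂.comp H.subtype = 1 ∨ s₁.comp H.subtype = s₂.comp H.subtype := by
  obtain ⟨h, hh⟩ : ∃ h : H, ∀ g : H, g = 1 ∨ g = h := by
    rcases hH with hH | hH
    · have := (Nat.card_eq_one_iff_unique.mp hH).1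
      exact ⟨1, fun g => Or.inl (Subsingleton.elim _ _)⟩
    · obtain ⟨h, -, hu⟩ := (Nat.card_eq_two_iff' (1 : H)).mp hH
      exact ⟨h, fun g => or_iff_not_imp_left.mpr (hu g)⟩
  have hext : ∀ χ ψ : H →* ℤˣ, χ h = ψ h → χ = ψ := by
    intro χ ψ hχ
    ext g
    rcases hh g with rfl | rfl
    · simp
    · rw [hχ]
  rcases Int.units_eq_one_or ((s₁.comp H.subtype) h) with h1 | h1
  · exact Or.inl (hext _ _ h1)
  rcases Int.units_eq_one_or ((s₂.comp H.subtype) h) with h2 | h2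
  · exact Or.inr (Or.inl (hext _ _ h2))
  · exact Or.inr (Or.inr (hext _ _ (h1.trans h2.symm)))

/-- The restriction of `1 + χ₁ + χ₂ + χ₁χ₂` to a subgroup of order at most two is divisible by
two. -/
theorem exists_res_charSum_eq (H : Subgroup Q8ab) (hH : Nat.card H = 1 ∨ Nat.card H = 2) :
    ∃ r, res H charSum = r + r := by
  have hmul : (s₁ * s₂).comp H.subtype = s₁.comp H.subtype * s₂.comp H.subtype := rfl
  have hone : (1 : Q8ab →* ℤˣ).comp H.subtype = 1 := rfl
  rw [charSum_eq, map_add, map_add, map_add, res_ofChar, res_ofChar, res_ofChar, res_ofChar, hmul,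
    hone]
  -- A nontrivial character that is trivial on `H` groups the four restrictions into two equal
  -- pairs.
  rcases exists_signChar_trivial H hH with h | h | h
  · rw [h, one_mul]
    exact ⟨RepGroup.ofChar (complexChar 1) + RepGroup.ofChar (complexChar (s₂.comp H.subtype)),
      by abel⟩
  · rw [h, mul_one]
    exact ⟨RepGroup.ofChar (complexChar 1) + RepGroup.ofChar (complexChar (s₁.comp H.subtype)),
      by abel⟩
  · have h2 : s₂.comp H.subtype * s₂.comp H.subtype = 1 := by
      ext g
      simp [Int.units_mul_self]
    rw [h, h2]
    exact ⟨RepGroup.ofChar (complexChar 1) + RepGroup.ofChar (complexChar (s₂.comp H.subtype)),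
      by abel⟩

/-- The pair of the valuation and the unit part at `1 + χ₁ + χ₂ + χ₁χ₂` modulo `4`. -/
def valuationUnitPart : HomQ Q8ab →+ (RepGroup Q8ab →+ ℤ) × Additive (ZMod 4)ˣ where
  toFun f := (valuationHom.comp f,
    Additive.ofMul (unitsMod4 (unitPartHom (f charSum).toMul)))
  map_zero' := by
    ext <;> simp
  map_add' f g := by
    ext <;> simp

theorem unitPartHom_charSum (f : HomQ Q8ab) : unitPartHom (f charSum).toMul =
    unitPartHom (f (RepGroup.ofChar (complexChar 1))).toMul *
    unitPartHom (f (RepGroup.ofChar (complexChar s₁))).toMul *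
    unitPartHom (f (RepGroup.ofChar (complexChar s₂))).toMul *
    unitPartHom (f (RepGroup.ofChar (complexChar (s₁ * s₂)))).toMul := by
  rw [charSum_eq]
  simp only [map_add, toMul_add, map_mul]

theorem valuationUnitPart_surjective : Function.Surjective valuationUnitPart := by
  rintro ⟨m, t⟩
  -- The function $2^m$ has valuation `m` and unit part 1, so only the sign modulo 4 remains to be
  -- adjusted.
  let f₀ : HomQ Q8ab :=
    (zmultiplesHom (Additive ℚ_[2]ˣ) (Additive.ofMul (Units.mk0 2 two_ne_zero))).comp m
  have hval : ∀ k : ℤ, valuationHom (k • Additive.ofMul (Units.mk0 2 two_ne_zero)) = k := by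
    intro k
    have h2 : valuationHom (Additive.ofMul (Units.mk0 2 two_ne_zero)) = 1 := Padic.valuation_p
    rw [map_zsmul, h2]
    simp
  have hunit : unitPartHom (Units.mk0 2 two_ne_zero) = 1 := by
    apply Units.ext
    apply Subtype.ext
    refine (coe_unitPart _).trans ?_
    have h2 : ((Units.mk0 (2 : ℚ_[2]) two_ne_zero : ℚ_[2]ˣ) : ℚ_[2]).valuation = 1 :=
      Padic.valuation_p
    rw [h2]
    simp
  have hf₀ : valuationUnitPart f₀ = (m, 0) := by
    refine Prod.ext ?_ ?_
    · ext r
      exact hval (m r)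
    · have : unitPartHom (f₀ charSum).toMul = 1 := by
        change unitPartHom ((Units.mk0 2 two_ne_zero) ^ (m charSum)) = 1
        rw [map_zpow, hunit, one_zpow]
      change Additive.ofMul (unitsMod4 (unitPartHom (f₀ charSum).toMul)) = 0
      rw [this, map_one]
      rfl
  have ht : t = 0 ∨ t = Additive.ofMul (-1) := by
    have : ∀ u : (ZMod 4)ˣ, u = 1 ∨ u = -1 := by decide
    exact this t.toMul
  rcases ht with rfl | rfl
  · exact ⟨f₀, hf₀⟩
  · classical
    -- Changing the sign at the trivial character alone leaves valuations zero and makes the value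
    -- at $s$ equal to $-1$.
    obtain ⟨g, hg⟩ := exists_homQ_ofChar q8ab_sq (fun χ => if χ = 1 then -1 else 1)
    have hneg : ((-1 : ℚ_[2]ˣ) : ℚ_[2]).valuation = 0 := by
      rw [← norm_eq_one_iff_valuation]
      simp
    have hgm : valuationUnitPart g = (0, Additive.ofMul (-1)) := by
      refine Prod.ext ?_ ?_
      · refine RepGroup.hom_ext q8ab_sq fun χ => ?_
        change ((g _).toMul : ℚ_[2]).valuation = 0
        rw [hg]
        by_cases h : χ = 1
        · simp only [h, if_true]
          exact hneg
        · simp [h]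
      · change Additive.ofMul (unitsMod4 (unitPartHom (g charSum).toMul)) = _
        rw [unitPartHom_charSum, hg, hg, hg, hg, if_pos rfl, if_neg one_ne_s₁.symm,
          if_neg one_ne_s₂.symm, if_neg (signChar_ne (Or.inl
            (by rw [MonoidHom.mul_apply, s₁_a, s₂_a, MonoidHom.one_apply]; decide)))]
        have : unitPartHom (-1) = -1 := by
          apply Units.ext
          apply Subtype.ext
          refine (coe_unitPart_of_valuation hneg).trans ?_
          simp
        simp only [toMul_ofMul, this, map_one, mul_one]
        congr 1
        ext
        simp [unitsMod4]
    exact ⟨f₀ + g, by rw [map_add, hf₀, hgm]; simp⟩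

/-- The character values of an element of `ℤ₂[G]` add up to zero modulo `4`. -/
theorem toZModPow_sum_evalSign (v : MonoidAlgebra ℤ_[2] Q8ab) :
    PadicInt.toZModPow 2 (evalSign ℤ_[2] 1 v + evalSign ℤ_[2] s₁ v + evalSign ℤ_[2] s₂ v +
      evalSign ℤ_[2] (s₁ * s₂) v) = 0 := by
  induction v using MonoidAlgebra.induction_linear with
  | zero => simp
  | add x y hx hy =>
    simp only [map_add] at hx hy ⊢
    linear_combination hx + hy
  | single g r =>
    -- The sum is $(1 + e_1)(1 + e_2)$, which is 0 or 4.
    have h : ∀ e₁ e₂ : ℤˣ, (1 : ZMod (2 ^ 2)) + ((e₁ : ℤ) : ZMod (2 ^ 2)) + ((e₂ : ℤ) : ZMod (2 ^ 2)) +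
        ((e₁ : ℤ) : ZMod (2 ^ 2)) * ((e₂ : ℤ) : ZMod (2 ^ 2)) = 0 := by decide
    have h' := h (s₁ g) (s₂ g)
    simp only [evalSign_single, map_add, map_mul, map_intCast, MonoidHom.mul_apply,
      MonoidHom.one_apply, Units.val_one, Int.cast_one, map_one, Units.val_mul, Int.cast_mul]
    linear_combination (PadicInt.toZModPow 2 r) * h'

/-- Integrality requires four congruences modulo 4, one for each group element. For unit values each
of them is equivalent to the product of the values being 1 modulo 4. -/
theorem ker_valuationUnitPart (ι : ℂ ≃+* AlgebraicClosure ℚ_[2]) :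
    valuationUnitPart.ker = detUnits ι Q8ab := by
  ext f
  rw [AddMonoidHom.mem_ker]
  constructor
  · intro hf
    have h1 : ∀ r, (f.val r).valuation = 0 := fun r =>
      DFunLike.congr_fun (congrArg Prod.fst hf) r
    have h2 : unitsMod4 (unitPartHom (f charSum).toMul) = 1 := congrArg Prod.snd hf
    rw [unitPartHom_charSum, map_mul, map_mul, map_mul] at h2
    have := Fintype.ofFinite (Q8ab →* ℤˣ)
    let a : (Q8ab →* ℤˣ) → ℤ_[2]ˣ := fun χ =>
      unitPart (f (RepGroup.ofChar (complexChar χ))).toMul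
    have ha : ∀ χ, ((a χ : ℤ_[2]) : ℚ_[2]) = f.val (RepGroup.ofChar (complexChar χ)) := fun χ =>
      coe_unitPart_of_valuation (h1 _)
    obtain ⟨v, hv⟩ := exists_evalSign_eq (fun χ => (a χ : ℤ_[2])) fun g => by
      -- The twist by the signs $1, e_1, e_2, e_1 e_2$ does not change the product, and four
      -- elements $\pm1$ with product 1 contain an even number of $-1$, so their sum is 0 modulo 4.
      have key : ∀ (e₁ e₂ : ℤˣ) (a b c d : (ZMod 4)ˣ), a * b * c * d = 1 →
        (a : ZMod 4) + ((e₁ : ℤ) : ZMod 4) * b + ((e₂ : ℤ) : ZMod 4) * c +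
          ((e₁ : ℤ) : ZMod 4) * ((e₂ : ℤ) : ZMod 4) * d = 0 := by decide
      have h3 := key (s₁ g) (s₂ g) _ _ _ _ h2
      have h4 : ∑ χ : Q8ab →* ℤˣ, ((χ g : ℤ) : ℤ_[2]) * a χ ∈
          RingHom.ker (PadicInt.toZModPow (p := 2) 2) := by
        rw [RingHom.mem_ker, sum_signChar_q8ab]
        simp only [map_add, map_mul, map_intCast, MonoidHom.mul_apply,
          MonoidHom.one_apply, Units.val_one, Int.cast_one, Units.val_mul, Int.cast_mul, one_mul]
        exact h3
      rw [PadicInt.ker_toZModPow, Ideal.mem_span_singleton] at h4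
      rw [card_q8ab]
      convert h4 using 1
      norm_num
    refine mem_detUnits_of_integral ι q8ab_sq f v (fun χ => ?_) ?_
    · rw [hv, ha]
    · rw [hv]
      exact (a 1).isUnit
  · intro hf
    obtain ⟨v, hv⟩ := (mem_detUnits_iff_exists_unit ι q8ab_sq f).mp hf
    have h1 : ∀ χ : Q8ab →* ℤˣ,
        ((f (RepGroup.ofChar (complexChar χ))).toMul : ℚ_[2]).valuation = 0 := by
      intro χ
      rw [← norm_eq_one_iff_valuation]
      exact (congrArg norm (hv χ)).trans (PadicInt.isUnit_iff.mp (v.isUnit.map (evalSign ℤ_[2] χ)))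
    have h2 : ∀ χ : Q8ab →* ℤˣ,
        (unitPartHom (f (RepGroup.ofChar (complexChar χ))).toMul : ℤ_[2]) =
          evalSign ℤ_[2] χ v := fun χ =>
      Subtype.ext ((coe_unitPart_of_valuation (h1 χ)).trans (hv χ))
    refine Prod.ext (RepGroup.hom_ext q8ab_sq h1) ?_
    change Additive.ofMul (unitsMod4 (unitPartHom (f charSum).toMul)) = Additive.ofMul 1
    -- Conversely, a vanishing sum modulo 4 forces an even number of $-1$; the congruence at the
    -- identity element suffices here.
    have key : ∀ (a b c d : (ZMod 4)ˣ), (a : ZMod 4) + b + c + d = 0 → a * b * c * d = 1 := by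
      decide
    refine congrArg Additive.ofMul ?_
    rw [unitPartHom_charSum, map_mul, map_mul, map_mul]
    apply key
    have h3 := toZModPow_sum_evalSign v
    rw [← h2, ← h2, ← h2, ← h2, map_add, map_add, map_add] at h3
    exact h3

end Quaternion

end RelK
end

open RelK in
theorem proposition2p6 (ι : ℂ ≃+* AlgebraicClosure ℚ_[2]) :
    ∃ (h : K0ZQ Q8ab ≃+ HomQ Q8ab ⧸ detUnits ι Q8ab)
      (Θ : K0ZQ Q8ab ≃+ (RepGroup Q8ab →+ ℤ) × Additive (ZMod 4)ˣ),
      IsHomDescription ι (detUnits ι Q8ab) h ∧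
      (∀ (z : K0ZQ Q8ab) (f : HomQ Q8ab), h z = QuotientAddGroup.mk f →
        (∀ r, (Θ z).1 r = (f.val r).valuation) ∧
        (Θ z).2 = Additive.ofMul (unitsMod4 (unitPart (f charSum).toMul))) ∧
      ∀ H : Subgroup Q8ab, (Nat.card H = 1 ∨ Nat.card H = 2) →
        ∃ hH : K0ZQ H ≃+ HomQ H ⧸ homZ H,
          IsHomDescription ι (homZ H) hH ∧
          ∀ (z : K0ZQ H) (f : HomQ H), hH z = QuotientAddGroup.mk f →
            (∀ r, (Θ (ind Q8ab H z)).1 r = (f.val (res H r)).valuation) ∧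
            (Θ (ind Q8ab H z)).2 = 0 := by
  have := isLocalRing_intGroupRing q8ab_sq
  obtain ⟨h, hh, hz⟩ := exists_homDescription ι q8ab_sq (detUnits ι Q8ab) rfl
  obtain ⟨e, he⟩ := exists_addEquiv_quotient valuationUnitPart valuationUnitPart_surjective
    (detUnits ι Q8ab) (ker_valuationUnitPart ι)
  have hΘ : ∀ f, (h.trans e.symm) (ofHomQ ι q8ab_sq f) = valuationUnitPart f := by
    intro f
    obtain ⟨z, hzf⟩ := h.surjective (QuotientAddGroup.mk f)
    rw [← hz z f hzf, AddEquiv.trans_apply, hzf, he]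
  refine ⟨h, h.trans e.symm, hh, fun z f hzf => ?_, fun H hH => ?_⟩
  · rw [hz z f hzf, hΘ]
    exact ⟨fun r => rfl, rfl⟩
  · have hH2 : ∀ g : H, g ^ 2 = 1 := fun g => Subtype.ext (q8ab_sq g)
    have := isLocalRing_intGroupRing hH2
    obtain ⟨hH', hd, hz'⟩ := exists_homDescription ι hH2 (homZ H) (detUnits_eq_homZ ι hH2 hH)
    refine ⟨hH', hd, fun z f hzf => ?_⟩
    rw [hz' z f hzf, ind_ofHomQ ι q8ab_sq, hΘ]
    refine ⟨fun r => rfl, ?_⟩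
    -- The value at $\mathrm{Res}(s) = 2r$ is a square, and all squares in $(\mathbf Z/4)^*$ are
    -- trivial.
    obtain ⟨r, hr⟩ := exists_res_charSum_eq H hH
    change Additive.ofMul (unitsMod4 (unitPartHom (f (res H charSum)).toMul)) = Additive.ofMul 1
    have hsq : ∀ t : (ZMod 4)ˣ, t * t = 1 := by decide
    rw [hr, map_add, toMul_add, map_mul, map_mul, hsq]
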